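/- Let $2 \le k < n$ be integers and write $[n]=\{1,\dots,n\}$. Let $S_n$ act on $\mathbb R^n$ by permuting coordinates, $\sigma(e_i)=e_{\sigma(i)}$, let $\rho(\sigma)$ denote the permutation matrix of $\sigma$, and let $\Delta_{k,n}=\{x\in[0,1]^n : x_1+\dots+x_n=k\}$ be the hypersimplex. For $m\ge 1$ let $\chi_m$ be the character of the permutation representation (over $\mathbb C$) of $S_n$ on the set $m\Delta_{k,n}\cap\mathbb Z^n$, and let $\chi_0$ be the trivial character. The equivariant $H^*$-series $H^*[t]=H^*(\Delta_{k,n};S_n)[t]$ is the power series, with class functions of $S_n$ as coefficients, determined by $$\sum_{m\ge 0}\chi_m(\sigma)\,t^m=\frac{H^*[t](\sigma)}{\det(I_n-t\,\rho(\sigma))}\qquad(\sigma\in S_n).$$ A $(k,n)$-DOSP (decorated ordered set partition) is a sequence $((L_1,\ell_1),\dots,(L_s,\ell_s))$, considered up to cyclic rotation, in which $(L_1,\dots,L_s)$ is an ordered partition of $[n]$ into non-empty sets and the $\ell_i$ are positive integers with $\ell_1+\dots+\ell_s=k$. It is hypersimplicial if $|L_i|>\ell_i$ for all $i$. The group $S_n$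 acts on the finite set of hypersimplicial $(k,n)$-DOSPs by replacing each $L_i$ with $\sigma(L_i)$. **Theorem.** The series $H^*[t]$ is a polynomial, and its value $H^*[1]$ at $t=1$ is equal to the permutation character of $S_n$ acting on the set of hypersimplicial $(k,n)$-DOSPs. In particular, $H^*[1](\sigma)$ is a non-negative integer for every $\sigma\in S_n$, and $H^*[1]$ is the character of a permutation representation of $S_n$, as conjectured by Stapledon. Explicitly, let $\sigma\in S_n$ have $r$ disjoint cycles (fixed points included), of which $\lambda_i$ have length $i$, for $i\in[n]$. Then the number of $\sigma$-fixed hypersimplicial $(k,n)$-DOSPs is $$H^*[1](\sigma)=g\sum_{h=0}^{k-1}\left(\sum_{I\in\mathcal I_h}(-1)^{|I|}\binom{\lambda_1}{I_1}\cdots\binom{\lambda_{k-1}}{I_{k-1}}\right)(k-h)^{r-1},$$ where $g=\gcd(\{k\}\cup\{i\in[n]:\lambda_i\ge1\})$, $\mathcal I_h=\{I=(I_1,\dots,I_{k-1})\in\mathbb Z_{\ge0}^{k-1}:\sum_{i=1}^{k-1} i\,I_i=h\}$, and $|I|=I_1+\dots+I_{k-1}$. -/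

import Mathlib

/-! ### Permutation representations and equivariant Ehrhart theory -/

namespace EqEhrhart

/-- The character of the permutation representation `ℂ^X` of a group `G` acting on `X`. -/
noncomputable def permCharacter (G X : Type*) [Group G] [MulAction G X] : G → ℂ :=
  (Representation.ofMulAction ℂ G X).character

/-- A function on `G` is the character of a permutation representation if it is the permutation
character of some finite `G`-set. -/
def IsPermCharacter {G : Type*} [Group G] (χ : G → ℂ) : Prop :=
  ∃ (X : Type) (_ : Finite X) (_ : MulAction G X), χ = permCharacter G X

section EhrhartTheory

variable {G : Type*} [Group G] {N : ℕ}

/-- The set `P ⊆ ℝ^N` is invariant under the group `G`, acting linearly on `ℝ^N` through the integral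
representation `ρ`. -/
def IsInvariant (ρ : G →* Matrix.GeneralLinearGroup (Fin N) ℤ) (P : Set (Fin N → ℝ)) : Prop :=
  ∀ g : G, (fun y : Fin N → ℝ =>
    ((ρ g : Matrix (Fin N) (Fin N) ℤ).map (fun z : ℤ => (z : ℝ))).mulVec y) '' P = P

/-- The lattice points of the dilate `mP`. -/
def latticePoints (P : Set (Fin N → ℝ)) (m : ℕ) : Set (Fin N → ℤ) :=
  {x | ∃ y ∈ P, (fun i => (x i : ℝ)) = (m : ℝ) • y}

theorem mulVec_mem_latticePoints {ρ : G →* Matrix.GeneralLinearGroup (Fin N) ℤ}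
    {P : Set (Fin N → ℝ)} (hP : IsInvariant ρ P) (m : ℕ) (g : G) {x : Fin N → ℤ}
    (hx : x ∈ latticePoints P m) :
    (ρ g : Matrix (Fin N) (Fin N) ℤ).mulVec x ∈ latticePoints P m := by
  obtain ⟨y, hy, hxy⟩ := hx
  refine ⟨((ρ g : Matrix (Fin N) (Fin N) ℤ).map (fun z : ℤ => (z : ℝ))).mulVec y, ?_, ?_⟩
  · have h := hP g
    rw [← h]
    exact ⟨y, hy, rfl⟩
  · rw [← Matrix.mulVec_smul, ← hxy]
    funext i
    simp [Matrix.mulVec, dotProduct]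

/-- The action of `G` on the lattice points of `mP` by `g • x = ρ(g) x`. -/
@[reducible] def latticeAction (ρ : G →* Matrix.GeneralLinearGroup (Fin N) ℤ)
    (P : Set (Fin N → ℝ)) (hP : IsInvariant ρ P) (m : ℕ) : MulAction G (latticePoints P m) where
  smul g x := ⟨(ρ g : Matrix (Fin N) (Fin N) ℤ).mulVec x.1, mulVec_mem_latticePoints hP m g x.2⟩
  one_smul x := by
    apply Subtype.ext
    change (ρ 1 : Matrix (Fin N) (Fin N) ℤ).mulVec x.1 = x.1
    simp
  mul_smul g h x := by
    apply Subtype.ext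
    change (ρ (g * h) : Matrix (Fin N) (Fin N) ℤ).mulVec x.1 =
      (ρ g : Matrix (Fin N) (Fin N) ℤ).mulVec ((ρ h : Matrix (Fin N) (Fin N) ℤ).mulVec x.1)
    simp [Matrix.mulVec_mulVec]

/-- The character `χ_m` of the permutation representation of `G` on the lattice points of `mP`;
by convention `χ_0` is the trivial character. -/
noncomputable def ehrhartCharacter (ρ : G →* Matrix.GeneralLinearGroup (Fin N) ℤ)
    (P : Set (Fin N → ℝ)) (hP : IsInvariant ρ P) : ℕ → G → ℂ
  | 0 => 1
  | m + 1 =>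
    letI := latticeAction ρ P hP (m + 1)
    permCharacter G (latticePoints P (m + 1))

/-- The equivariant Ehrhart series `∑ χ_m t^m`, a power series over the ring of functions on `G`
(a virtual representation is identified with its character). -/
noncomputable def equivariantEhrhartSeries (ρ : G →* Matrix.GeneralLinearGroup (Fin N) ℤ)
    (P : Set (Fin N → ℝ)) (hP : IsInvariant ρ P) : PowerSeries (G → ℂ) :=
  PowerSeries.mk (ehrhartCharacter ρ P hP)

/-- The function `g ↦ det(I - t ρ(g))`, as a power series in `t` over the functions on `G`
(`Matrix.charpolyRev M` is `det(I - t M)`). -/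
noncomputable def detSeries (ρ : G →* Matrix.GeneralLinearGroup (Fin N) ℤ) :
    PowerSeries (G → ℂ) :=
  PowerSeries.mk fun i g => (((ρ g : Matrix (Fin N) (Fin N) ℤ).charpolyRev.coeff i : ℤ) : ℂ)

/-- The equivariant `H^*`-series, determined by
`∑ χ_m t^m = H^*(P; G)[t] / det(I - t ρ)`. -/
noncomputable def HStar (ρ : G →* Matrix.GeneralLinearGroup (Fin N) ℤ)
    (P : Set (Fin N → ℝ)) (hP : IsInvariant ρ P) : PowerSeries (G → ℂ) :=
  equivariantEhrhartSeries ρ P hP * detSeries ρ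

end EhrhartTheory

/-! ### The hypersimplex with its action of the symmetric group -/

/-- The representation of `S_n` by permutation matrices, `(σ x)_i = x_{σ⁻¹ i}`,
so that `σ e_i = e_{σ i}`. -/
def permGL (n : ℕ) : Equiv.Perm (Fin n) →* Matrix.GeneralLinearGroup (Fin n) ℤ :=
  MonoidHom.toHomUnits
    { toFun := fun σ => σ⁻¹.permMatrix ℤ
      map_one' := by simp
      map_mul' := fun σ τ => by simp [Matrix.permMatrix_mul] }

/-- The `(k,n)`-hypersimplex `{x ∈ [0,1]^n : x_1 + ⋯ + x_n = k}`. -/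
def hypersimplex (k n : ℕ) : Set (Fin n → ℝ) :=
  {x | (∀ i, 0 ≤ x i ∧ x i ≤ 1) ∧ ∑ i, x i = k}

theorem permGL_mulVec (n : ℕ) (σ : Equiv.Perm (Fin n)) (y : Fin n → ℝ) :
    ((permGL n σ : Matrix (Fin n) (Fin n) ℤ).map (fun z : ℤ => (z : ℝ))).mulVec y =
      fun i => y (σ⁻¹ i) := by
  funext i
  simp [permGL, Matrix.mulVec, dotProduct, Equiv.Perm.permMatrix, PEquiv.toMatrix_apply,
    Equiv.toPEquiv_apply]

theorem hypersimplex_isInvariant (k n : ℕ) : IsInvariant (permGL n) (hypersimplex k n) := by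
  have key : ∀ (σ : Equiv.Perm (Fin n)) (y : Fin n → ℝ), y ∈ hypersimplex k n →
      (fun i => y (σ i)) ∈ hypersimplex k n := fun σ y hy =>
    ⟨fun i => hy.1 _, (Equiv.sum_comp σ y).trans hy.2⟩
  intro σ
  ext x
  simp only [permGL_mulVec, Set.mem_image]
  constructor
  · rintro ⟨y, hy, rfl⟩
    exact key _ y hy
  · intro hx
    exact ⟨fun i => x (σ i), key σ x hx, by simp⟩

/-- `H^*(Δ_{k,n}; S_n)`. -/
noncomputable def hypersimplexHStar (k n : ℕ) : PowerSeries (Equiv.Perm (Fin n) → ℂ) :=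
  HStar (permGL n) (hypersimplex k n) (hypersimplex_isInvariant k n)

/-! ### Decorated ordered set partitions -/

/-- An ordered set partition `(L_1, …, L_r)` of the ground set into non-empty parts, with positive
decorations `(ℓ_1, …, ℓ_r)` of sum `k`, before passing to cyclic rotation. -/
structure PreDOSP (k n : ℕ) where
  blocks : List (Finset (Fin n) × ℕ)
  nonempty : ∀ p ∈ blocks, p.1.Nonempty
  disjoint : blocks.Pairwise fun p q => Disjoint p.1 q.1
  cover : ∀ i, ∃ p ∈ blocks, i ∈ p.1
  pos : ∀ p ∈ blocks, 0 < p.2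
  sum_eq : (blocks.map Prod.snd).sum = k

/-- Equality up to cyclic rotation of the sequence of pairs `(L_i, ℓ_i)`. -/
instance PreDOSP.setoid (k n : ℕ) : Setoid (PreDOSP k n) :=
  (List.IsRotated.setoid (Finset (Fin n) × ℕ)).comap PreDOSP.blocks

/-- `(k,n)`-DOSPs: decorated ordered set partitions up to cyclic rotation. -/
def DOSP (k n : ℕ) : Type := Quotient (PreDOSP.setoid k n)

/-- The action of a permutation: `L_i` is replaced with `σ(L_i)`. -/
def PreDOSP.act {k n : ℕ} (σ : Equiv.Perm (Fin n)) (D : PreDOSP k n) : PreDOSP k n where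
  blocks := D.blocks.map fun p => (p.1.map σ.toEmbedding, p.2)
  nonempty := by
    intro p hp
    obtain ⟨q, hq, rfl⟩ := List.mem_map.1 hp
    exact (D.nonempty q hq).map
  disjoint := by
    rw [List.pairwise_map]
    exact D.disjoint.imp fun h => (Finset.disjoint_map _).2 h
  cover := by
    intro i
    obtain ⟨p, hp, hi⟩ := D.cover (σ⁻¹ i)
    exact ⟨_, List.mem_map_of_mem hp, Finset.mem_map.2 ⟨_, hi, by simp⟩⟩
  pos := by
    intro p hp
    obtain ⟨q, hq, rfl⟩ := List.mem_map.1 hp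
    exact D.pos q hq
  sum_eq := by
    rw [List.map_map]
    exact D.sum_eq

theorem PreDOSP.ext' {k n : ℕ} {D E : PreDOSP k n} (h : D.blocks = E.blocks) : D = E := by
  cases D; cases E; cases h; rfl

instance DOSP.mulAction (k n : ℕ) : MulAction (Equiv.Perm (Fin n)) (DOSP k n) where
  smul σ := Quotient.map (PreDOSP.act σ) fun _ _ h => List.IsRotated.map h _
  one_smul D := by
    induction D using Quotient.inductionOn with
    | h D =>
      refine congrArg (Quotient.mk _) (PreDOSP.ext' ?_)
      change D.blocks.map (fun p => (p.1.map (Equiv.toEmbedding 1), p.2)) = D.blocks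
      conv_rhs => rw [← List.map_id D.blocks]
      refine List.map_congr_left fun p _ => Prod.ext (Finset.ext fun i => ?_) rfl
      rw [Finset.mem_map_equiv]
      rfl
  mul_smul σ τ D := by
    induction D using Quotient.inductionOn with
    | h D =>
      refine congrArg (Quotient.mk _) (PreDOSP.ext' ?_)
      change D.blocks.map _ = (D.blocks.map _).map _
      rw [List.map_map]
      refine List.map_congr_left fun p _ => Prod.ext (Finset.ext fun i => ?_) rfl
      simp only [Function.comp_apply, Finset.mem_map_equiv]
      rfl

/-- A DOSP is hypersimplicial if `|L_i| > ℓ_i` for each `i`. -/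
def DOSP.IsHypersimplicial {k n : ℕ} (D : DOSP k n) : Prop :=
  Quotient.liftOn D (fun E => ∀ p ∈ E.blocks, p.2 < p.1.card) fun _ _ h =>
    propext ⟨fun H p hp => H p (List.IsRotated.mem_iff h |>.2 hp),
      fun H p hp => H p (List.IsRotated.mem_iff h |>.1 hp)⟩

theorem DOSP.IsHypersimplicial.smul {k n : ℕ} (σ : Equiv.Perm (Fin n)) {D : DOSP k n}
    (hD : D.IsHypersimplicial) : (σ • D).IsHypersimplicial := by
  induction D using Quotient.inductionOn with
  | h D =>
    intro p hp
    obtain ⟨q, hq, rfl⟩ := List.mem_map.1 hp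
    simpa using hD q hq

/-- The set of hypersimplicial `(k,n)`-DOSPs. -/
def HypersimplicialDOSP (k n : ℕ) : Type := {D : DOSP k n // D.IsHypersimplicial}

instance HypersimplicialDOSP.mulAction (k n : ℕ) :
    MulAction (Equiv.Perm (Fin n)) (HypersimplicialDOSP k n) where
  smul σ D := ⟨σ • D.1, D.2.smul σ⟩
  one_smul D := Subtype.ext (one_smul _ D.1)
  mul_smul σ τ D := Subtype.ext (mul_smul σ τ D.1)

theorem PreDOSP.length_le {k n : ℕ} (D : PreDOSP k n) : D.blocks.length ≤ k := by
  have h : ∀ l : List (Finset (Fin n) × ℕ), (∀ p ∈ l, 0 < p.2) →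
      l.length ≤ (l.map Prod.snd).sum := by
    intro l
    induction l with
    | nil => simp
    | cons a l ih =>
      intro hl
      have h1 := hl a (by simp)
      have h2 := ih fun p hp => hl p (by simp [hp])
      simp only [List.length_cons, List.map_cons, List.sum_cons]
      omega
  exact (h D.blocks D.pos).trans D.sum_eq.le

instance PreDOSP.finite (k n : ℕ) : Finite (PreDOSP k n) := by
  have hfin : Finite {l : List (Finset (Fin n) × Fin (k + 1)) // l.length ≤ k} :=
    (List.finite_length_le _ k).to_subtype
  refine Finite.of_injective (β := {l : List (Finset (Fin n) × Fin (k + 1)) // l.length ≤ k})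
    (fun D => ⟨D.blocks.map fun p => (p.1, Fin.ofNat (k + 1) p.2),
      by simpa using D.length_le⟩) ?_
  intro D E h
  have hle : ∀ F : PreDOSP k n, (F.blocks.map fun p => (p.1, Fin.ofNat (k + 1) p.2)).map
      (fun p => (p.1, (p.2 : ℕ))) = F.blocks := by
    intro F
    rw [List.map_map]
    conv_rhs => rw [← List.map_id F.blocks]
    refine List.map_congr_left fun p hp => Prod.ext rfl ?_
    have h1 : p.2 ≤ k := by
      have := List.single_le_sum (l := F.blocks.map Prod.snd) (by simp) p.2
        (List.mem_map_of_mem hp)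
      rwa [F.sum_eq] at this
    simp [Nat.mod_eq_of_lt (Nat.lt_succ_of_le h1)]
  apply PreDOSP.ext'
  rw [← hle D, ← hle E]
  exact congrArg _ (Subtype.ext_iff.1 h)

instance DOSP.finite (k n : ℕ) : Finite (DOSP k n) := Quotient.finite _

instance HypersimplicialDOSP.finite (k n : ℕ) : Finite (HypersimplicialDOSP k n) :=
  Subtype.finite

/-! ### The ingredients of the explicit formula -/

/-- `λ_i`: the number of cycles of length `i` of `σ` (fixed points are cycles of length `1`). -/
def numCyclesOfLength {n : ℕ} (σ : Equiv.Perm (Fin n)) (i : ℕ) : ℕ := σ.partition.parts.count i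

/-- `r`: the number of disjoint cycles of `σ`, fixed points included. -/
def numCycles {n : ℕ} (σ : Equiv.Perm (Fin n)) : ℕ := σ.partition.parts.card

/-- `𝓘_h`: the tuples `I = (I_1, …, I_{k-1})` of non-negative integers with `∑ i • I_i = h`;
here `I j` stands for `I_{j+1}`. -/
def tuplesOfWeight (k h : ℕ) : Finset (Fin (k - 1) → ℕ) :=
  (Fintype.piFinset fun _ => Finset.range (h + 1)).filter
    fun I => ∑ j : Fin (k - 1), ((j : ℕ) + 1) * I j = h

theorem mem_tuplesOfWeight {k h : ℕ} {I : Fin (k - 1) → ℕ} :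
    I ∈ tuplesOfWeight k h ↔ ∑ j : Fin (k - 1), ((j : ℕ) + 1) * I j = h := by
  simp only [tuplesOfWeight, Finset.mem_filter, Fintype.mem_piFinset, Finset.mem_range,
    and_iff_right_iff_imp]
  rintro rfl j
  have h1 := Finset.single_le_sum (f := fun j : Fin (k - 1) => ((j : ℕ) + 1) * I j)
    (fun _ _ => Nat.zero_le _) (Finset.mem_univ j)
  have h2 : I j ≤ ((j : ℕ) + 1) * I j := Nat.le_mul_of_pos_left _ (Nat.succ_pos _)
  exact Nat.lt_succ_of_le (h2.trans h1)

end EqEhrhart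

/-! Both sides are evaluated at each `σ` and turn out to equal `g * ∑_{h<k} W_h (k-h)^(r-1)`, where
`W = ∏ (1 - t^len)` runs over the `r` cycles of `σ` (`weightPoly`), `W_h` is its coefficient of
`t^h`, and `g` is the gcd of `k` and all the cycle lengths.

DOSP side. Put the blocks on the cycle `ℤ/k`, with consecutive blocks separated by their
decorations. A DOSP becomes a function `f : [n] → ℤ/k` up to translation, normalised by `f j₀ = 0`.
It is hypersimplicial when each fibre is larger than the gap to the next occupied place, and it is
fixed by `σ` when `f (σ i) = f i + c` for some `c`. Such an `f` exists only if every cycle length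
kills `c`, which leaves `g` values of `c`. If `c` has order `e`, then `f` amounts to a function on
the cycles, and the hypersimplicial condition depends only on its reduction mod `k/e`, with cycles
weighted by `len/e` (`isHSFun_iff_of_twisted`). Each normalised reduced function has `e^(r-1)`
lifts. The reduced functions are counted by a generating function obtained by splitting off the
first block (`numHS_head`), and scaling the weights by `e` absorbs the factor `e^(r-1)`. So all
admissible `c` contribute the same number (`card_twisted_isHSFun`).

Ehrhart side. The determinant is `W(t)` (`charpolyRev_permMatrix_inv`), and `χ_m(σ)` is the
coefficient of `t^(km)` in `W(t^(m+1)) / W(t)`. Expanding the numerator and multiplying the series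
over `m` by `W(t)` leaves a finite sum of polynomials (`mk_boxPoly_mul_weightPoly`). At `t = 1` its
terms count solutions of linear congruences, which again gives the formula
(`numeratorPoly_eval_one`). -/

namespace EqEhrhart

/-! ### Decorated ordered partitions and their placement on the cycle `ℤ/k`. -/

section DecoratedLists

variable {α : Type*} [DecidableEq α]

/-- The list `l` of pairs `(L_i, ℓ_i)` is an ordered partition of `S` into non-empty sets, with
positive decorations of sum `k`. -/
def IsDecPart : List (Finset α × ℕ) → Finset α → ℕ → Prop
  | [], S, k => S = ∅ ∧ k = 0
  | p :: l, S, k => p.1.Nonempty ∧ p.1 ⊆ S ∧ 0 < p.2 ∧ p.2 ≤ k ∧ IsDecPart l (S \ p.1) (k - p.2)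

/-- The sum of the decorations of the blocks that precede the block containing `i`. -/
def offset : List (Finset α × ℕ) → α → ℕ
  | [], _ => 0
  | p :: l, i => if i ∈ p.1 then 0 else p.2 + offset l i

/-- The recursive form suits inductions that peel off the first block; this flat form matches the
fields of `PreDOSP` and is visibly invariant under reordering. -/
theorem isDecPart_iff (l : List (Finset α × ℕ)) (S : Finset α) (k : ℕ) :
    IsDecPart l S k ↔ (∀ p ∈ l, p.1.Nonempty) ∧ (l.Pairwise fun p q => Disjoint p.1 q.1) ∧
      (∀ i, i ∈ S ↔ ∃ p ∈ l, i ∈ p.1) ∧ (∀ p ∈ l, 0 < p.2) ∧ (l.map Prod.snd).sum = k := by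
  induction l generalizing S k with
  | nil => simp [IsDecPart, Finset.eq_empty_iff_forall_notMem, eq_comm]
  | cons p l ih =>
    simp only [IsDecPart, ih, List.pairwise_cons, List.mem_cons, forall_eq_or_imp,
      exists_eq_or_imp, List.map_cons, List.sum_cons, Finset.mem_sdiff]
    constructor
    · rintro ⟨h1, h2, h3, h4, h5, h6, h7, h8, h9⟩
      refine ⟨⟨h1, h5⟩, ⟨fun q hq => ?_, h6⟩, fun i => ?_, ⟨h3, h8⟩, by omega⟩
      · rw [Finset.disjoint_left]
        exact fun i hi hiq => ((h7 i).2 ⟨q, hq, hiq⟩).2 hi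
      · rw [← h7]
        by_cases hi : i ∈ p.1
        · simp [hi, h2 hi]
        · simp [hi]
    · rintro ⟨⟨h1, h5⟩, ⟨h6', h6⟩, h7, ⟨h3, h8⟩, h9⟩
      refine ⟨h1, fun i hi => (h7 i).2 (Or.inl hi), h3, by omega, h5, h6, fun i => ?_, h8, by omega⟩
      rw [h7]
      constructor
      · rintro ⟨h | h, h'⟩
        · exact absurd h h'
        · exact h
      · rintro ⟨q, hq, hi⟩
        exact ⟨Or.inr ⟨q, hq, hi⟩, fun hp => Finset.disjoint_left.1 (h6' q hq) hp hi⟩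

theorem IsDecPart.perm {l l' : List (Finset α × ℕ)} {S : Finset α} {k : ℕ} (h : IsDecPart l S k)
    (hl : l.Perm l') : IsDecPart l' S k := by
  rw [isDecPart_iff] at h ⊢
  obtain ⟨h1, h2, h3, h4, h5⟩ := h
  refine ⟨fun p hp => h1 p (hl.mem_iff.2 hp), (hl.pairwise_iff fun h => h.symm).1 h2, fun i => ?_,
    fun p hp => h4 p (hl.mem_iff.2 hp), ?_⟩
  · simp only [h3, hl.mem_iff]
  · rw [← h5]
    exact ((hl.map _).sum_eq).symm

theorem IsDecPart.eq_nil {l : List (Finset α × ℕ)} {k : ℕ} (h : IsDecPart l ∅ k) :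
    l = [] ∧ k = 0 := by
  cases l with
  | nil => exact ⟨rfl, h.2⟩
  | cons p l => exact absurd (Finset.subset_empty.1 h.2.1) h.1.ne_empty

theorem IsDecPart.exists_cons {l : List (Finset α × ℕ)} {S : Finset α} {k : ℕ}
    (h : IsDecPart l S k) (hS : S.Nonempty) : ∃ p t, l = p :: t := by
  cases l with
  | nil => exact absurd h.1 hS.ne_empty
  | cons p t => exact ⟨p, t, rfl⟩

theorem IsDecPart.offset_lt {l : List (Finset α × ℕ)} {S : Finset α} {k : ℕ}
    (h : IsDecPart l S k) {i : α} (hi : i ∈ S) : offset l i < k := by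
  induction l generalizing S k with
  | nil => simp [h.1] at hi
  | cons p l ih =>
    obtain ⟨-, -, h3, h4, h5⟩ := h
    unfold offset
    split_ifs with hp
    · omega
    · have := ih h5 (Finset.mem_sdiff.2 ⟨hi, hp⟩)
      omega

theorem offset_cons_eq_zero_iff {p : Finset α × ℕ} {l : List (Finset α × ℕ)} (hp : 0 < p.2)
    (i : α) : offset (p :: l) i = 0 ↔ i ∈ p.1 := by
  unfold offset
  split_ifs with h <;> simp [h]
  omega

theorem IsDecPart.exists_offset_eq_zero {l : List (Finset α × ℕ)} {S : Finset α} {k : ℕ}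
    (h : IsDecPart l S k) (hS : S.Nonempty) : ∃ j ∈ S, offset l j = 0 := by
  obtain ⟨p, t, rfl⟩ := h.exists_cons hS
  obtain ⟨h1, h2, h3, -, -⟩ := h
  obtain ⟨j, hj⟩ := h1
  exact ⟨j, h2 hj, (offset_cons_eq_zero_iff h3 j).2 hj⟩

/-- The zero set of the offsets is the first block, and the least offset outside it is the first
decoration (or that decoration is `k` if nothing is left). Subtracting it gives the offsets of the
tail. -/
theorem IsDecPart.eq_of_offset_eq {l l' : List (Finset α × ℕ)} {S : Finset α} {k : ℕ}
    (h : IsDecPart l S k) (h' : IsDecPart l' S k) (heq : ∀ i ∈ S, offset l i = offset l' i) :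
    l = l' := by
  induction l generalizing l' S k with
  | nil =>
    rw [h.1] at h'
    exact h'.eq_nil.1.symm
  | cons p l ih =>
    obtain ⟨⟨L, b⟩, l', rfl⟩ := h'.exists_cons (h.1.mono h.2.1)
    obtain ⟨K, a⟩ := p
    obtain ⟨h1, h2, h3, h4, h5⟩ := h
    obtain ⟨h1', h2', h3', h4', h5'⟩ := h'
    dsimp only at *
    obtain rfl : K = L := by
      ext i
      constructor
      · intro hi
        have := heq i (h2 hi)
        rw [(offset_cons_eq_zero_iff (p := (K, a)) h3 i).2 hi] at this
        exact (offset_cons_eq_zero_iff (p := (L, b)) h3' i).1 this.symm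
      · intro hi
        have := heq i (h2' hi)
        rw [(offset_cons_eq_zero_iff (p := (L, b)) h3' i).2 hi] at this
        exact (offset_cons_eq_zero_iff (p := (K, a)) h3 i).1 this
    have heq' : ∀ i ∈ S \ K, a + offset l i = b + offset l' i := by
      intro i hi
      rw [Finset.mem_sdiff] at hi
      have := heq i hi.1
      simpa [offset, hi.2] using this
    obtain rfl : a = b := by
      rcases (S \ K).eq_empty_or_nonempty with hE | hE
      · rw [hE] at h5 h5'
        have := h5.eq_nil.2
        have := h5'.eq_nil.2
        omega
      · obtain ⟨i, hi, hi0⟩ := h5.exists_offset_eq_zero hE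
        obtain ⟨j, hj, hj0⟩ := h5'.exists_offset_eq_zero hE
        have := heq' i hi
        have := heq' j hj
        omega
    rw [ih h5 h5' fun i hi => by simpa using heq' i hi]

/-- The blocks are the level sets of `f` in increasing order, the decorations are the successive
differences of the values, and the last decoration is `k` minus the largest value. -/
theorem exists_isDecPart_offset_eq {S : Finset α} (hS : S.Nonempty) {k : ℕ} (f : α → ℕ)
    (hf0 : ∃ j ∈ S, f j = 0) (hf : ∀ i ∈ S, f i < k) :
    ∃ l, IsDecPart l S k ∧ ∀ i ∈ S, offset l i = f i := by
  induction S using Finset.strongInduction generalizing k f with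
  | H S ih =>
    obtain ⟨j, hj, hj0⟩ := hf0
    set L := S.filter fun i => f i = 0 with hL
    have hLS : L ⊆ S := Finset.filter_subset _ _
    have hLn : L.Nonempty := ⟨j, by simp [hL, hj, hj0]⟩
    rcases (S \ L).eq_empty_or_nonempty with hE | hE
    · refine ⟨[(L, k)], ⟨hLn, hLS, (Nat.zero_le _).trans_lt (hf j hj), le_rfl, hE, by simp⟩,
        fun i hi => ?_⟩
      have hiL : i ∈ L := by
        by_contra h
        simpa [hE] using Finset.mem_sdiff.2 ⟨hi, h⟩
      have := (Finset.mem_filter.1 hiL).2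
      simp [offset, hiL, this]
    · obtain ⟨m, hm, hmin⟩ := Finset.exists_min_image (S \ L) f hE
      have hm' := Finset.mem_sdiff.1 hm
      have hm0 : 0 < f m := Nat.pos_of_ne_zero fun h => hm'.2 (by simp [hL, hm'.1, h])
      have hmk := hf m hm'.1
      obtain ⟨t, ht, hto⟩ := ih (S \ L) (Finset.sdiff_ssubset hLS hLn) hE (k := k - f m)
        (fun i => f i - f m) ⟨m, hm, by simp⟩ (fun i hi => by
          have := hf i (Finset.mem_sdiff.1 hi).1
          omega)
      refine ⟨(L, f m) :: t, ⟨hLn, hLS, hm0, hmk.le, ht⟩, fun i hi => ?_⟩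
      unfold offset
      split_ifs with hiL
      · exact (Finset.mem_filter.1 hiL).2.symm
      · have hi' := Finset.mem_sdiff.2 ⟨hi, hiL⟩
        have := hmin i hi'
        rw [hto i hi']
        dsimp only
        omega

theorem offset_append_of_mem {l₁ : List (Finset α × ℕ)} (l₂ : List (Finset α × ℕ)) {i : α}
    (h : ∃ p ∈ l₁, i ∈ p.1) : offset (l₁ ++ l₂) i = offset l₁ i := by
  induction l₁ with
  | nil => simp at h
  | cons p l ih =>
    simp only [List.cons_append, offset]
    split_ifs with hp
    · rfl
    · rw [ih]
      simpa [hp] using h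

theorem offset_append_of_not_mem {l₁ : List (Finset α × ℕ)} (l₂ : List (Finset α × ℕ)) {i : α}
    (h : ¬ ∃ p ∈ l₁, i ∈ p.1) :
    offset (l₁ ++ l₂) i = (l₁.map Prod.snd).sum + offset l₂ i := by
  induction l₁ with
  | nil => simp
  | cons p l ih =>
    simp only [List.mem_cons, exists_eq_or_imp, not_or] at h
    simp only [List.cons_append, offset, if_neg h.1, ih h.2, List.map_cons, List.sum_cons]
    omega

theorem exists_isRotated_cons_of_mem {β : Type*} {l : List β} {p : β} (h : p ∈ l) :
    ∃ t, l.IsRotated (p :: t) := by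
  obtain ⟨a, b, rfl⟩ := List.append_of_mem h
  exact ⟨b ++ a, by simpa using List.isRotated_append (l := a) (l' := p :: b)⟩

theorem exists_append_of_isRotated {β : Type*} {l l' : List β} (h : l.IsRotated l') :
    ∃ a b, l = a ++ b ∧ l' = b ++ a := by
  obtain ⟨n, hn, rfl⟩ := List.isRotated_iff_mod.1 h
  exact ⟨l.take n, l.drop n, (List.take_append_drop n l).symm,
    List.rotate_eq_drop_append_take hn⟩

variable [Fintype α]

/-- Rotating `a ++ b` to `b ++ a` adds the decoration sum of `b` to offsets in `a` and subtracts
that of `a` from offsets in `b`. These shifts agree mod `k`, the total sum. -/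
theorem IsDecPart.exists_offset_eq_add {l l' : List (Finset α × ℕ)} {k : ℕ}
    (h : IsDecPart l Finset.univ k) (hl : l.IsRotated l') :
    ∃ c : ZMod k, ∀ i, (offset l' i : ZMod k) = offset l i + c := by
  obtain ⟨a, b, rfl, rfl⟩ := exists_append_of_isRotated hl
  have h' := h.perm hl.perm
  rw [isDecPart_iff] at h
  obtain ⟨-, hd, hc, -, hs⟩ := h
  rw [List.map_append, List.sum_append] at hs
  rw [List.pairwise_append] at hd
  refine ⟨((b.map Prod.snd).sum : ℕ), fun i => ?_⟩
  by_cases hi : ∃ p ∈ a, i ∈ p.1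
  · have hi' : ¬ ∃ p ∈ b, i ∈ p.1 := by
      rintro ⟨q, hq, hiq⟩
      obtain ⟨p, hp, hip⟩ := hi
      exact Finset.disjoint_left.1 (hd.2.2 p hp q hq) hip hiq
    rw [offset_append_of_mem _ hi, offset_append_of_not_mem _ hi']
    push_cast
    ring
  · have hi' : ∃ p ∈ b, i ∈ p.1 := by
      obtain ⟨p, hp, hip⟩ := (hc i).1 (Finset.mem_univ i)
      rcases List.mem_append.1 hp with hp | hp
      · exact absurd ⟨p, hp, hip⟩ hi
      · exact ⟨p, hp, hip⟩
    rw [offset_append_of_mem _ hi', offset_append_of_not_mem _ hi]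
    have : (((a.map Prod.snd).sum : ℕ) : ZMod k) + ((b.map Prod.snd).sum : ℕ) = 0 := by
      rw [← Nat.cast_add, hs, ZMod.natCast_self]
    push_cast at this ⊢
    linear_combination -this

/-- The hypersimplicial condition, for the blocks `f⁻¹(p)` placed on the cycle `ℤ/k` and with
weights `w`: the weight of each block exceeds the distance to the next block. -/
def IsHSFun {k : ℕ} (w : α → ℕ) (f : α → ZMod k) : Prop :=
  ∀ i, ∃ j, ∃ g : ℕ, 0 < g ∧ g < ∑ x ∈ Finset.univ.filter (fun x => f x = f i), w x ∧
    f j = f i + g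

theorem isHSFun_add_const {β : Type*} [Fintype β] {k : ℕ} (w : β → ℕ) (f : β → ZMod k)
    (c : ZMod k) :
    IsHSFun w (fun i => f i + c) ↔ IsHSFun w f := by
  unfold IsHSFun
  simp only [add_left_inj, add_right_comm _ c]

theorem IsDecPart.head_lt_iff {p : Finset α × ℕ} {t : List (Finset α × ℕ)} {k : ℕ}
    (h : IsDecPart (p :: t) Finset.univ k) (w : α → ℕ) {i : α} (hi : i ∈ p.1) :
    p.2 < ∑ x ∈ p.1, w x ↔ ∃ j, ∃ g : ℕ, 0 < g ∧
      g < ∑ x ∈ Finset.univ.filter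
        (fun x => (offset (p :: t) x : ZMod k) = offset (p :: t) i), w x ∧
      (offset (p :: t) j : ZMod k) = offset (p :: t) i + g := by
  have hlt := fun x => h.offset_lt (Finset.mem_univ x)
  have h0 : offset (p :: t) i = 0 := (offset_cons_eq_zero_iff h.2.2.1 i).2 hi
  have hfib : Finset.univ.filter (fun x => (offset (p :: t) x : ZMod k) = offset (p :: t) i)
      = p.1 := by
    ext x
    rw [Finset.mem_filter, ← offset_cons_eq_zero_iff (l := t) h.2.2.1 x, h0]
    simp only [Finset.mem_univ, true_and, ZMod.natCast_eq_natCast_iff, Nat.ModEq,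
      Nat.mod_eq_of_lt (hlt x), Nat.zero_mod]
  rw [hfib, h0]
  obtain ⟨h1, h2, h3, h4, h5⟩ := h
  constructor
  · intro hp
    cases t with
    | nil =>
      have : p.2 = k := by have := h5.2; omega
      -- A single block is its own successor, one full turn away.
      exact ⟨i, k, by omega, by omega, by simp [h0]⟩
    | cons q t =>
      obtain ⟨j, hj⟩ := h5.1
      refine ⟨j, p.2, h3, hp, ?_⟩
      have hjp : j ∉ p.1 := (Finset.mem_sdiff.1 (h5.2.1 hj)).2
      simp [offset, hjp, hj]
  · rintro ⟨j, g, hg0, hg, hj⟩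
    refine lt_of_le_of_lt ?_ hg
    -- A gap of at least `k` dominates any decoration. A smaller gap is the true offset of `j`;
    -- being nonzero, it places `j` after the first block, hence at distance at least `p.2`.
    by_cases hgk : k ≤ g
    · exact h4.trans hgk
    · have hjg : offset (p :: t) j = g := by
        have : ((offset (p :: t) j : ℕ) : ZMod k) = (g : ℕ) := by simpa using hj
        rwa [ZMod.natCast_eq_natCast_iff, Nat.ModEq, Nat.mod_eq_of_lt (hlt j),
          Nat.mod_eq_of_lt (not_le.1 hgk)] at this
      have hjp : j ∉ p.1 := fun hjp => by
        rw [(offset_cons_eq_zero_iff h3 j).2 hjp] at hjg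
        omega
      simp only [offset, if_neg hjp] at hjg
      omega

/-- Rotation only translates the offsets, which preserves `IsHSFun`, so each block in turn may be
assumed to come first. -/
theorem IsDecPart.isHSFun_offset_iff {l : List (Finset α × ℕ)} {k : ℕ}
    (h : IsDecPart l Finset.univ k) (w : α → ℕ) :
    IsHSFun w (fun i => (offset l i : ZMod k)) ↔ ∀ p ∈ l, p.2 < ∑ x ∈ p.1, w x := by
  have key : ∀ p ∈ l, ∃ t, l.IsRotated (p :: t) ∧ IsDecPart (p :: t) Finset.univ k ∧
      (IsHSFun w (fun i => (offset l i : ZMod k)) ↔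
        IsHSFun w (fun i => (offset (p :: t) i : ZMod k))) := by
    intro p hp
    obtain ⟨t, ht⟩ := exists_isRotated_cons_of_mem hp
    obtain ⟨c, hc⟩ := h.exists_offset_eq_add ht
    refine ⟨t, ht, h.perm ht.perm, ?_⟩
    simp only [hc]
    exact (isHSFun_add_const w _ c).symm
  constructor
  · intro H p hp
    obtain ⟨t, -, hd, hiff⟩ := key p hp
    obtain ⟨i, hi⟩ := hd.1
    exact (hd.head_lt_iff w hi).2 (hiff.1 H i)
  · intro H i
    obtain ⟨p, hp, hi⟩ := (((isDecPart_iff _ _ _).1 h).2.2.1 i).1 (Finset.mem_univ i)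
    obtain ⟨t, ht, hd, -⟩ := key p hp
    obtain ⟨c, hc⟩ := h.exists_offset_eq_add ht
    have := (hd.head_lt_iff w hi).1 (H p hp)
    simpa only [hc, add_left_inj, add_right_comm _ c] using this

end DecoratedLists

/-! ### Counting weighted hypersimplicial partitions. -/

section Count

variable {α : Type*}

/-- The number of decorated ordered partitions of `S` of decoration sum `k` such that the weight
of every block exceeds its decoration and the first block satisfies `h`. -/
noncomputable def numHS [DecidableEq α] (w : α → ℕ) (h : Finset α → Prop) (S : Finset α)
    (k : ℕ) : ℕ :=
  Nat.card {l : List (Finset α × ℕ) // IsDecPart l S k ∧ (∀ p ∈ l, p.2 < ∑ x ∈ p.1, w x) ∧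
    ∀ p ∈ l.head?, h p.1}

open Classical in
/-- The possible first blocks in `numHS`. -/
noncomputable def headBlocks (w : α → ℕ) (h : Finset α → Prop) (S : Finset α) (k : ℕ) :
    Finset (Finset α × ℕ) :=
  ((S.powerset.filter fun L => L.Nonempty ∧ h L) ×ˢ Finset.Icc 1 k).filter
    fun q => q.2 < ∑ x ∈ q.1, w x

theorem mem_headBlocks {w : α → ℕ} {h : Finset α → Prop} {S : Finset α} {k : ℕ}
    {q : Finset α × ℕ} : q ∈ headBlocks w h S k ↔ q.1 ⊆ S ∧ q.1.Nonempty ∧ h q.1 ∧ 0 < q.2 ∧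
      q.2 ≤ k ∧ q.2 < ∑ x ∈ q.1, w x := by
  simp only [headBlocks, Finset.mem_filter, Finset.mem_product, Finset.mem_powerset,
    Finset.mem_Icc, Nat.succ_le_iff, and_assoc]

variable [DecidableEq α]

/-- Splitting off the first block. -/
def consEquiv (w : α → ℕ) (h : Finset α → Prop) {S : Finset α} (hS : S.Nonempty) (k : ℕ) :
    {l : List (Finset α × ℕ) // IsDecPart l S k ∧ (∀ p ∈ l, p.2 < ∑ x ∈ p.1, w x) ∧
      ∀ p ∈ l.head?, h p.1} ≃
    Σ q : headBlocks w h S k, {l : List (Finset α × ℕ) // IsDecPart l (S \ q.1.1) (k - q.1.2) ∧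
      (∀ p ∈ l, p.2 < ∑ x ∈ p.1, w x) ∧ ∀ p ∈ l.head?, True} where
  toFun := fun
    | ⟨[], hl⟩ => absurd hl.1.1 hS.ne_empty
    | ⟨p :: t, hl⟩ => ⟨⟨p, mem_headBlocks.2 ⟨hl.1.2.1, hl.1.1, hl.2.2 p rfl, hl.1.2.2.1,
        hl.1.2.2.2.1, hl.2.1 p List.mem_cons_self⟩⟩, ⟨t, hl.1.2.2.2.2,
        fun q hq => hl.2.1 q (List.mem_cons_of_mem _ hq), fun _ _ => trivial⟩⟩
  invFun x := ⟨x.1.1 :: x.2.1, by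
    obtain ⟨⟨q, hq⟩, ⟨t, ht⟩⟩ := x
    rw [mem_headBlocks] at hq
    refine ⟨⟨hq.2.1, hq.1, hq.2.2.2.1, hq.2.2.2.2.1, ht.1⟩, ?_, ?_⟩
    · simp only [List.mem_cons, forall_eq_or_imp]
      exact ⟨hq.2.2.2.2.2, ht.2.1⟩
    · simpa using hq.2.2.1⟩
  left_inv := by
    rintro ⟨_ | ⟨p, t⟩, hl⟩
    · exact absurd hl.1.1 hS.ne_empty
    · rfl
  right_inv := by
    rintro ⟨⟨q, hq⟩, ⟨t, ht⟩⟩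
    rfl

theorem finite_decPart (w : α → ℕ) (h : Finset α → Prop) (S : Finset α) (k : ℕ) :
    Finite {l : List (Finset α × ℕ) // IsDecPart l S k ∧ (∀ p ∈ l, p.2 < ∑ x ∈ p.1, w x) ∧
      ∀ p ∈ l.head?, h p.1} := by
  induction S using Finset.strongInduction generalizing h k with
  | H S ih =>
    rcases S.eq_empty_or_nonempty with rfl | hS
    · have : Subsingleton {l : List (Finset α × ℕ) // IsDecPart l ∅ k ∧
          (∀ p ∈ l, p.2 < ∑ x ∈ p.1, w x) ∧ ∀ p ∈ l.head?, h p.1} :=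
        ⟨fun a b => Subtype.ext (a.2.1.eq_nil.1.trans b.2.1.eq_nil.1.symm)⟩
      infer_instance
    · have : ∀ q : headBlocks w h S k, Finite {l : List (Finset α × ℕ) //
          IsDecPart l (S \ q.1.1) (k - q.1.2) ∧
          (∀ p ∈ l, p.2 < ∑ x ∈ p.1, w x) ∧ ∀ p ∈ l.head?, True} := fun q =>
        ih _ (Finset.sdiff_ssubset (mem_headBlocks.1 q.2).1 (mem_headBlocks.1 q.2).2.1)
          (fun _ => True) _
      exact Finite.of_equiv _ (consEquiv w h hS k).symm

theorem numHS_empty (w : α → ℕ) (h : Finset α → Prop) (k : ℕ) :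
    numHS w h ∅ k = if k = 0 then 1 else 0 := by
  unfold numHS
  split_ifs with hk
  · rw [Nat.card_eq_one_iff_unique]
    exact ⟨⟨fun a b => Subtype.ext (a.2.1.eq_nil.1.trans b.2.1.eq_nil.1.symm)⟩,
      ⟨[], ⟨rfl, hk⟩, by simp, by simp⟩⟩
  · rw [Nat.card_eq_zero]
    exact Or.inl ⟨fun a => hk a.2.1.eq_nil.2⟩

theorem numHS_eq_sum (w : α → ℕ) (h : Finset α → Prop) {S : Finset α} (hS : S.Nonempty) (k : ℕ) :
    numHS w h S k =
      ∑ q ∈ headBlocks w h S k, numHS w (fun _ => True) (S \ q.1) (k - q.2) := by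
  have := fun q : headBlocks w h S k => finite_decPart w (fun _ => True) (S \ q.1.1) (k - q.1.2)
  unfold numHS
  rw [Nat.card_congr (consEquiv w h hS k), Nat.card_sigma]
  exact Finset.sum_coe_sort (headBlocks w h S k) fun q =>
    numHS w (fun _ => True) (S \ q.1) (k - q.2)

/-! ### Generating functions of the counts. -/

open PowerSeries

theorem mk_numHS_eq_sum (w : α → ℕ) (h : Finset α → Prop) {S : Finset α} (hS : S.Nonempty)
    {T : Finset (Finset α)} (hT : ∀ L, L ∈ T ↔ L ⊆ S ∧ L.Nonempty ∧ h L) :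
    (PowerSeries.mk fun k => (numHS w h S k : ℤ)) =
      ∑ L ∈ T,
        (∑ l ∈ Finset.Ico 1 (∑ x ∈ L, w x), (X : ℤ⟦X⟧) ^ l) *
          PowerSeries.mk fun k => (numHS w (fun _ => True) (S \ L) k : ℤ) := by
  classical
  obtain rfl : T = S.powerset.filter fun L => L.Nonempty ∧ h L := by
    ext L
    simp [hT]
  ext k
  rw [coeff_mk, numHS_eq_sum w h hS, headBlocks, Finset.sum_filter, Finset.sum_product, map_sum]
  push_cast
  refine Finset.sum_congr rfl fun L _ => ?_
  rw [Finset.sum_mul, map_sum]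
  simp only [coeff_X_pow_mul', coeff_mk]
  rw [← Finset.sum_filter, ← Finset.sum_filter]
  refine Finset.sum_congr ?_ fun _ _ => rfl
  ext l
  simp only [Finset.mem_filter, Finset.mem_Icc, Finset.mem_Ico]
  tauto

theorem one_sub_X_mul_sum_Ico {m : ℕ} (hm : 0 < m) :
    (1 - X : ℤ⟦X⟧) * ∑ l ∈ Finset.Ico 1 m, X ^ l = X - X ^ m := by
  induction m, hm using Nat.le_induction with
  | base => simp
  | succ m hm ih =>
    rw [Finset.sum_Ico_succ_top hm, mul_add, ih]
    ring

/-- A closed form for the generating function of `numHS w (fun _ => True) S`, modulo `X ^ K`. -/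
noncomputable def hsSeries (w : α → ℕ) (K : ℕ) (S : Finset α) : ℤ⟦X⟧ :=
  (1 - X) * ∑ s ∈ Finset.range K, (X : ℤ⟦X⟧) ^ s * ∏ j ∈ S, ((s : ℤ⟦X⟧) - (s + 1 : ℤ⟦X⟧) * X ^ w j)

/-- Product expansion of `X^w + (s - (s+1) X^w) = s (1 - X^w)`. -/
theorem sum_powerset_X_pow_mul (w : α → ℕ) (S : Finset α) (s : ℕ) :
    ∑ L ∈ S.powerset, (X : ℤ⟦X⟧) ^ (∑ x ∈ L, w x) *
        ∏ j ∈ S \ L, ((s : ℤ⟦X⟧) - (s + 1 : ℤ⟦X⟧) * X ^ w j) =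
      (s : ℤ⟦X⟧) ^ S.card * ∏ j ∈ S, (1 - X ^ w j) := by
  simp only [← Finset.prod_pow_eq_pow_sum]
  rw [← Finset.prod_add, ← Finset.prod_const, ← Finset.prod_mul_distrib]
  exact Finset.prod_congr rfl fun j _ => by ring

/-- Product expansion of `1 + (s - (s+1) X^w) = (s+1) (1 - X^w)`. -/
theorem sum_powerset_prod_sdiff (w : α → ℕ) (S : Finset α) (s : ℕ) :
    ∑ L ∈ S.powerset, ∏ j ∈ S \ L, ((s : ℤ⟦X⟧) - (s + 1 : ℤ⟦X⟧) * X ^ w j) =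
      (s + 1 : ℤ⟦X⟧) ^ S.card * ∏ j ∈ S, (1 - X ^ w j) := by
  have := Finset.prod_add (fun _ => (1 : ℤ⟦X⟧)) (fun j => (s : ℤ⟦X⟧) - (s + 1 : ℤ⟦X⟧) * X ^ w j) S
  simp only [Finset.prod_const_one, one_mul] at this
  rw [← this, ← Finset.prod_const, ← Finset.prod_mul_distrib]
  exact Finset.prod_congr rfl fun j _ => by ring

/-- Up to the factor `1 - X`, this is the effect of prepending a block. It is used with `a = 0` for
an arbitrary first block, where the sum over `s` telescopes, and with `a = w j₀` for a first block
containing `j₀`. -/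
theorem sum_powerset_mul_hsSeries (w : α → ℕ) (K : ℕ) (S : Finset α) (a : ℕ) :
    ∑ L ∈ S.powerset, (X - X ^ (a + ∑ x ∈ L, w x)) * hsSeries w K (S \ L) =
      (1 - X) * ((∏ j ∈ S, (1 - X ^ w j)) * ∑ s ∈ Finset.range K,
        (X ^ (s + 1) * ((s + 1 : ℕ) : ℤ⟦X⟧) ^ S.card - X ^ a * (X ^ s * (s : ℤ⟦X⟧) ^ S.card))) := by
  have h2 : ∀ s : ℕ, (∏ j ∈ S, (1 - X ^ w j)) * (X ^ (s + 1) * ((s + 1 : ℕ) : ℤ⟦X⟧) ^ S.card -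
      X ^ a * (X ^ s * (s : ℤ⟦X⟧) ^ S.card)) =
      X ^ s * (X * ∑ L ∈ S.powerset, ∏ j ∈ S \ L, ((s : ℤ⟦X⟧) - (s + 1 : ℤ⟦X⟧) * X ^ w j) - X ^ a *
        ∑ L ∈ S.powerset, (X : ℤ⟦X⟧) ^ (∑ x ∈ L, w x) *
          ∏ j ∈ S \ L, ((s : ℤ⟦X⟧) - (s + 1 : ℤ⟦X⟧) * X ^ w j)) := fun s => by
    rw [sum_powerset_X_pow_mul, sum_powerset_prod_sdiff]
    push_cast
    ring
  rw [Finset.mul_sum (Finset.range K), Finset.sum_congr rfl fun s _ => h2 s]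
  simp only [hsSeries, Finset.mul_sum, ← Finset.sum_sub_distrib]
  rw [Finset.sum_comm]
  refine Finset.sum_congr rfl fun s _ => Finset.sum_congr rfl fun L _ => ?_
  ring

theorem X_pow_dvd_of_one_sub_X_mul {K : ℕ} {f : ℤ⟦X⟧} (h : X ^ K ∣ (1 - X) * f) : X ^ K ∣ f := by
  have hu : IsUnit (1 - X : ℤ⟦X⟧) := by
    rw [PowerSeries.isUnit_iff_constantCoeff]
    simp
  exact (hu.dvd_mul_left).1 h

/-- Both series satisfy the first-block recursion modulo `X^K`: the term `L = ∅` of the telescoped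
identity is `-(1 - X)` times the closed form for `S`, so the nonempty `L` determine it. -/
theorem X_pow_dvd_numHS_sub (w : α → ℕ) (hw : ∀ i, 0 < w i) (K : ℕ) (S : Finset α) :
    X ^ K ∣ (PowerSeries.mk fun k => (numHS w (fun _ => True) S k : ℤ)) - hsSeries w K S := by
  classical
  induction S using Finset.strongInduction with
  | H S ih =>
    rcases S.eq_empty_or_nonempty with rfl | hS
    · have h1 : (PowerSeries.mk fun k => (numHS w (fun _ => True) ∅ k : ℤ)) = 1 := by
        ext k
        rw [coeff_mk, numHS_empty, coeff_one]
        split_ifs <;> rfl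
      have h2 : hsSeries w K ∅ = 1 - X ^ K := by
        simp only [hsSeries, Finset.prod_empty, mul_one]
        exact mul_neg_geom_sum (X : ℤ⟦X⟧) K
      rw [h1, h2]
      exact ⟨1, by ring⟩
    · apply X_pow_dvd_of_one_sub_X_mul
      have hpos : ∀ L : Finset α, L.Nonempty → 0 < ∑ x ∈ L, w x := fun L hL =>
        Finset.sum_pos (fun i _ => hw i) hL
      have h0 := sum_powerset_mul_hsSeries w K S 0
      -- The lower end `0 ^ S.card` of the telescoping sum vanishes because `S` is nonempty.
      have htel : ∑ s ∈ Finset.range K, (X ^ (s + 1) * ((s + 1 : ℕ) : ℤ⟦X⟧) ^ S.card -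
          X ^ 0 * (X ^ s * (s : ℤ⟦X⟧) ^ S.card)) = X ^ K * (K : ℤ⟦X⟧) ^ S.card := by
        have := Finset.sum_range_sub (fun s => X ^ s * (s : ℤ⟦X⟧) ^ S.card) K
        simp only [pow_zero, one_mul]
        rw [this]
        simp [hS.card_ne_zero]
      rw [htel, ← Finset.add_sum_erase _ _ (Finset.empty_mem_powerset S)] at h0
      simp only [Finset.sum_empty, pow_zero, zero_add, Finset.sdiff_empty] at h0
      have hN : (1 - X) * (PowerSeries.mk fun k => (numHS w (fun _ => True) S k : ℤ)) =
          ∑ L ∈ S.powerset.erase ∅, (X - X ^ (∑ x ∈ L, w x)) *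
            PowerSeries.mk fun k => (numHS w (fun _ => True) (S \ L) k : ℤ) := by
        rw [mk_numHS_eq_sum w _ hS (T := S.powerset.erase ∅) fun L => by
          simp [Finset.nonempty_iff_ne_empty, and_comm], Finset.mul_sum]
        refine Finset.sum_congr rfl fun L hL => ?_
        rw [← mul_assoc, one_sub_X_mul_sum_Ico (hpos L
          (Finset.nonempty_iff_ne_empty.2 (Finset.ne_of_mem_erase hL)))]
      have hdvd : X ^ K ∣ ∑ L ∈ S.powerset.erase ∅, (X - X ^ (∑ x ∈ L, w x)) *
          ((PowerSeries.mk fun k => (numHS w (fun _ => True) (S \ L) k : ℤ)) -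
            hsSeries w K (S \ L)) := by
        refine Finset.dvd_sum fun L hL => Dvd.dvd.mul_left (ih _ ?_) _
        exact Finset.sdiff_ssubset (Finset.mem_powerset.1 (Finset.mem_of_mem_erase hL))
          (Finset.nonempty_iff_ne_empty.2 (Finset.ne_of_mem_erase hL))
      simp only [mul_sub (_ - _) (PowerSeries.mk _), Finset.sum_sub_distrib] at hdvd
      rw [← hN] at hdvd
      have heq : (1 - X) * ((PowerSeries.mk fun k => (numHS w (fun _ => True) S k : ℤ)) -
          hsSeries w K S) = ((1 - X) * (PowerSeries.mk fun k =>
            (numHS w (fun _ => True) S k : ℤ)) - ∑ L ∈ S.powerset.erase ∅,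
              (X - X ^ (∑ x ∈ L, w x)) * hsSeries w K (S \ L)) +
            X ^ K * ((1 - X) * ((∏ j ∈ S, (1 - X ^ w j)) * (K : ℤ⟦X⟧) ^ S.card)) := by
        linear_combination h0
      rw [heq]
      exact dvd_add hdvd (Dvd.intro _ rfl)

variable [Fintype α]

/-- The first block is `j₀` together with any subset of the other points, and the later blocks are
unconstrained, so the closed form `hsSeries` applies to them. -/
theorem X_pow_dvd_numHS_head_sub (w : α → ℕ) (hw : ∀ i, 0 < w i) (K : ℕ) (j₀ : α) :
    X ^ K ∣ (PowerSeries.mk fun k => (numHS w (fun L => j₀ ∈ L) Finset.univ k : ℤ)) -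
      (∏ j ∈ Finset.univ.erase j₀, (1 - X ^ w j)) * ∑ s ∈ Finset.range K,
        (X ^ (s + 1) * ((s + 1 : ℕ) : ℤ⟦X⟧) ^ (Finset.univ.erase j₀).card -
          X ^ w j₀ * (X ^ s * (s : ℤ⟦X⟧) ^ (Finset.univ.erase j₀).card)) := by
  apply X_pow_dvd_of_one_sub_X_mul
  rw [mul_sub, ← sum_powerset_mul_hsSeries, mk_numHS_eq_sum w _ ⟨j₀, Finset.mem_univ _⟩
    (T := Finset.univ.filter fun L => j₀ ∈ L) fun L => by
      simpa using fun h => ⟨j₀, h⟩, Finset.mul_sum]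
  have hre : ∑ L ∈ Finset.univ.filter (fun L : Finset α => j₀ ∈ L),
      (1 - X) * ((∑ l ∈ Finset.Ico 1 (∑ x ∈ L, w x), (X : ℤ⟦X⟧) ^ l) *
          PowerSeries.mk fun k => (numHS w (fun _ => True) (Finset.univ \ L) k : ℤ)) =
      ∑ L ∈ (Finset.univ.erase j₀).powerset, (X - X ^ (w j₀ + ∑ x ∈ L, w x)) *
        PowerSeries.mk fun k =>
          (numHS w (fun _ => True) (Finset.univ.erase j₀ \ L) k : ℤ) := by
    refine Finset.sum_bij' (fun L _ => L.erase j₀) (fun L _ => insert j₀ L) ?_ ?_ ?_ ?_ ?_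
    · intro L _
      rw [Finset.mem_powerset]
      exact Finset.erase_subset_erase _ (Finset.subset_univ _)
    · intro L _
      simp
    · intro L hL
      exact Finset.insert_erase (Finset.mem_filter.1 hL).2
    · intro L hL
      exact Finset.erase_insert fun h =>
        Finset.notMem_erase j₀ _ (Finset.mem_powerset.1 hL h)
    · intro L hL
      have hj := (Finset.mem_filter.1 hL).2
      rw [Finset.add_sum_erase _ _ hj, ← mul_assoc, one_sub_X_mul_sum_Ico
        (Finset.sum_pos (fun i _ => hw i) ⟨j₀, hj⟩)]
      have : Finset.univ.erase j₀ \ L.erase j₀ = Finset.univ \ L := by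
        ext x
        by_cases hx : x = j₀ <;> simp [hx, hj]
      rw [this]
  rw [hre, ← Finset.sum_sub_distrib]
  refine Finset.dvd_sum fun L _ => ?_
  rw [← mul_sub]
  exact Dvd.dvd.mul_left (X_pow_dvd_numHS_sub w hw K _) _

/-- The polynomial `∏ (1 - t ^ w i)`. -/
noncomputable def weightPoly {β : Type*} [Fintype β] (w : β → ℕ) : Polynomial ℤ :=
  ∏ i, (1 - Polynomial.X ^ w i)

/-- The two sums in `X_pow_dvd_numHS_head_sub` are the same series `∑ s^r X^s` up to end terms, so
its coefficients `1` and `-X^(w j₀)` supply the factor missing from `W`. The count is then a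
coefficient of `W * ∑ s^r X^s`. -/
theorem numHS_head (w : α → ℕ) (hw : ∀ i, 0 < w i) (j₀ : α) {k : ℕ} (hk : k < ∑ i, w i) :
    (numHS w (fun L => j₀ ∈ L) Finset.univ k : ℤ) =
      ∑ h ∈ Finset.range k, (weightPoly w).coeff h * ((k : ℤ) - h) ^ (Fintype.card α - 1) := by
  set r := Fintype.card α - 1 with hr
  have hcard : (Finset.univ.erase j₀).card = r := by
    rw [Finset.card_erase_of_mem (Finset.mem_univ _), Finset.card_univ]
  have hW : ((weightPoly w : Polynomial ℤ) : ℤ⟦X⟧) = (1 - X ^ w j₀) *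
      ∏ j ∈ Finset.univ.erase j₀, (1 - X ^ w j) := by
    rw [Finset.mul_prod_erase _ (fun j => (1 - X ^ w j : ℤ⟦X⟧)) (Finset.mem_univ _), weightPoly,
      ← Polynomial.coeToPowerSeries.ringHom_apply, map_prod]
    simp [Polynomial.coeToPowerSeries.ringHom_apply]
  have hdvd := X_pow_dvd_numHS_head_sub w hw (k + 1) j₀
  rw [PowerSeries.X_pow_dvd_iff] at hdvd
  have hc := hdvd k (Nat.lt_succ_self k)
  rw [map_sub, coeff_mk, sub_eq_zero, hcard] at hc
  rw [hc]
  have hsplit : (∏ j ∈ Finset.univ.erase j₀, (1 - X ^ w j)) * ∑ s ∈ Finset.range (k + 1),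
        (X ^ (s + 1) * ((s + 1 : ℕ) : ℤ⟦X⟧) ^ r - X ^ w j₀ * (X ^ s * (s : ℤ⟦X⟧) ^ r)) =
      (weightPoly w : ℤ⟦X⟧) * (∑ s ∈ Finset.range (k + 1), X ^ (s + 1) * ((s + 1 : ℕ) : ℤ⟦X⟧) ^ r)
      - (∏ j ∈ Finset.univ.erase j₀, (1 - X ^ w j)) * X ^ w j₀ * (0 : ℤ⟦X⟧) ^ r
      + X ^ (k + 1) * ((∏ j ∈ Finset.univ.erase j₀, (1 - X ^ w j)) * X ^ w j₀ *
        ((k + 1 : ℕ) : ℤ⟦X⟧) ^ r) := by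
    have h1 := Finset.sum_range_succ (fun s : ℕ => X ^ s * (s : ℤ⟦X⟧) ^ r) (k + 1)
    rw [Finset.sum_range_succ' (fun s : ℕ => X ^ s * (s : ℤ⟦X⟧) ^ r)] at h1
    simp only [pow_zero, Nat.cast_zero, one_mul] at h1
    rw [Finset.sum_sub_distrib, ← Finset.mul_sum, hW]
    linear_combination (∏ j ∈ Finset.univ.erase j₀, (1 - X ^ w j)) * X ^ w j₀ * h1
  -- The end term at `s = 0` survives only for a single point, where `0 ^ 0 = 1`; it then sits in
  -- degree `w j₀`, which exceeds `k`.
  have hzero : coeff k ((∏ j ∈ Finset.univ.erase j₀, (1 - X ^ w j)) * X ^ w j₀ *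
      (0 : ℤ⟦X⟧) ^ r) = 0 := by
    by_cases hr0 : r = 0
    · have hE : Finset.univ.erase j₀ = ∅ := Finset.card_eq_zero.1 (hcard.trans hr0)
      have hsum : ∑ i, w i = w j₀ := by
        rw [← Finset.add_sum_erase _ _ (Finset.mem_univ j₀), hE]
        simp
      rw [hE, hr0]
      simp only [Finset.prod_empty, one_mul, pow_zero, mul_one, coeff_X_pow]
      rw [if_neg]
      omega
    · simp [hr0]
  rw [hsplit, map_add, map_sub, hzero, coeff_X_pow_mul', if_neg (by omega), add_zero, sub_zero,
    mul_comm, coeff_mul, Finset.Nat.sum_antidiagonal_eq_sum_range_succ_mk]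
  have hcoef : ∀ m ≤ k, coeff m (∑ s ∈ Finset.range (k + 1),
      X ^ (s + 1) * ((s + 1 : ℕ) : ℤ⟦X⟧) ^ r) = if m = 0 then 0 else (m : ℤ) ^ r := by
    intro m hm
    rw [map_sum]
    have : ∀ s : ℕ, coeff m (X ^ (s + 1) * ((s + 1 : ℕ) : ℤ⟦X⟧) ^ r) =
        if s + 1 = m then (m : ℤ) ^ r else 0 := by
      intro s
      have hC : (((s + 1 : ℕ) : ℤ⟦X⟧)) ^ r = C (((s + 1 : ℕ) : ℤ) ^ r) := by
        rw [map_pow, map_natCast]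
      rw [hC, coeff_mul_C, coeff_X_pow]
      by_cases h : s + 1 = m
      · simp [h]
      · simp [h, Ne.symm h]
    simp only [this]
    cases m with
    | zero => simp
    | succ m =>
      simp only [Nat.add_right_cancel_iff]
      rw [Finset.sum_ite_eq' , if_pos (Finset.mem_range.2 (by omega))]
      simp
  rw [Finset.sum_range_succ', ← Finset.sum_range_reflect, hcoef 0 (Nat.zero_le _)]
  simp only [if_true, zero_mul, add_zero]
  refine Finset.sum_congr rfl fun h hh => ?_
  have hh' := Finset.mem_range.1 hh
  rw [hcoef _ (by omega), if_neg (by omega), Polynomial.coeff_coe, mul_comm]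
  have e1 : k - (k - 1 - h + 1) = h := by omega
  have e2 : k - 1 - h + 1 = k - h := by omega
  rw [e1, e2, Nat.cast_sub hh'.le]

/-- Functions to `ℤ/k` that vanish at `j₀` are decorated ordered partitions whose first block
contains `j₀`. -/
noncomputable def decPartEquiv (w : α → ℕ) (j₀ : α) {k : ℕ} (hk : 0 < k) :
    {l : List (Finset α × ℕ) // IsDecPart l Finset.univ k ∧ (∀ p ∈ l, p.2 < ∑ x ∈ p.1, w x) ∧
      ∀ p ∈ l.head?, j₀ ∈ p.1} ≃ {f : α → ZMod k // f j₀ = 0 ∧ IsHSFun w f} :=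
  Equiv.ofBijective (fun l => ⟨fun i => (offset l.1 i : ZMod k), by
      obtain ⟨l, hl, -, hj⟩ := l
      obtain ⟨p, t, rfl⟩ := hl.exists_cons ⟨j₀, Finset.mem_univ _⟩
      simp [(offset_cons_eq_zero_iff hl.2.2.1 j₀).2 (hj p rfl)],
    (l.2.1.isHSFun_offset_iff w).2 l.2.2.1⟩) <| by
  constructor
  · rintro ⟨l, hl⟩ ⟨l', hl'⟩ h
    refine Subtype.ext (hl.1.eq_of_offset_eq hl'.1 fun i _ => ?_)
    have := congrFun (Subtype.ext_iff.1 h) i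
    simp only [ZMod.natCast_eq_natCast_iff, Nat.ModEq] at this
    rwa [Nat.mod_eq_of_lt (hl.1.offset_lt (Finset.mem_univ i)),
      Nat.mod_eq_of_lt (hl'.1.offset_lt (Finset.mem_univ i))] at this
  · rintro ⟨f, hf0, hf⟩
    have : NeZero k := ⟨hk.ne'⟩
    obtain ⟨l, hl, hlf⟩ := exists_isDecPart_offset_eq (S := (Finset.univ : Finset α))
      ⟨j₀, Finset.mem_univ _⟩ (k := k) (fun i => (f i).val)
      ⟨j₀, Finset.mem_univ _, by simp [hf0]⟩ (fun i _ => ZMod.val_lt _)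
    have hfl : (fun i => (offset l i : ZMod k)) = f := by
      funext i
      simp [hlf i (Finset.mem_univ i)]
    refine ⟨⟨l, hl, (hl.isHSFun_offset_iff w).1 (by rwa [hfl]), ?_⟩, Subtype.ext hfl⟩
    obtain ⟨p, t, rfl⟩ := hl.exists_cons ⟨j₀, Finset.mem_univ _⟩
    intro q hq
    obtain rfl : p = q := by simpa using hq
    rw [← offset_cons_eq_zero_iff (l := t) hl.2.2.1, hlf j₀ (Finset.mem_univ _)]
    simp [hf0]

theorem card_isHSFun (w : α → ℕ) (hw : ∀ i, 0 < w i) (j₀ : α) {k : ℕ} (hk : 0 < k)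
    (hkw : k < ∑ i, w i) :
    (Nat.card {f : α → ZMod k // f j₀ = 0 ∧ IsHSFun w f} : ℤ) =
      ∑ h ∈ Finset.range k, (weightPoly w).coeff h * ((k : ℤ) - h) ^ (Fintype.card α - 1) := by
  rw [← Nat.card_congr (decPartEquiv w j₀ hk)]
  exact numHS_head w hw j₀ hkw

end Count

/-! ### DOSPs as functions to `ℤ/k`, and the action of permutations on them. -/

section DOSPFun

variable {k n : ℕ}

theorem PreDOSP.isDecPart (D : PreDOSP k n) : IsDecPart D.blocks Finset.univ k :=
  (isDecPart_iff _ _ _).2 ⟨D.nonempty, D.disjoint,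
    fun i => ⟨fun _ => D.cover i, fun _ => Finset.mem_univ i⟩, D.pos, D.sum_eq⟩

/-- The placement of the blocks of a DOSP on the cycle `ℤ/k`, with the block of `j₀` at `0`. -/
noncomputable def dospFun (j₀ : Fin n) : DOSP k n → Fin n → ZMod k :=
  Quotient.lift (fun D i => (offset D.blocks i : ZMod k) - offset D.blocks j₀) <| by
    intro D E h
    obtain ⟨c, hc⟩ := D.isDecPart.exists_offset_eq_add h
    funext i
    rw [hc, hc]
    ring

theorem dospFun_mk (j₀ : Fin n) (D : PreDOSP k n) :
    dospFun j₀ (Quotient.mk _ D) =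
      fun i => (offset D.blocks i : ZMod k) - offset D.blocks j₀ := rfl

theorem dospFun_self (j₀ : Fin n) (D : DOSP k n) : dospFun j₀ D j₀ = 0 := by
  induction D using Quotient.inductionOn with
  | h D => simp [dospFun_mk]

theorem exists_offset_eq_zero_rep (j₀ : Fin n) (D : DOSP k n) :
    ∃ E : PreDOSP k n, Quotient.mk _ E = D ∧ offset E.blocks j₀ = 0 := by
  induction D using Quotient.inductionOn with
  | h D =>
    obtain ⟨p, hp, hj⟩ := D.cover j₀
    obtain ⟨t, ht⟩ := exists_isRotated_cons_of_mem hp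
    have hd := D.isDecPart.perm ht.perm
    have h := (isDecPart_iff _ _ _).1 hd
    exact ⟨⟨p :: t, h.1, h.2.1, fun i => (h.2.2.1 i).1 (Finset.mem_univ i), h.2.2.2.1,
      h.2.2.2.2⟩, Quotient.sound ht.symm, (offset_cons_eq_zero_iff hd.2.2.1 j₀).2 hj⟩

theorem dospFun_injective (j₀ : Fin n) : Function.Injective (dospFun (k := k) j₀) := by
  intro D D' h
  obtain ⟨E, rfl, hE⟩ := exists_offset_eq_zero_rep j₀ D
  obtain ⟨E', rfl, hE'⟩ := exists_offset_eq_zero_rep j₀ D'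
  refine congrArg _ (PreDOSP.ext' (E.isDecPart.eq_of_offset_eq E'.isDecPart fun i _ => ?_))
  have := congrFun h i
  rw [dospFun_mk, dospFun_mk] at this
  simp only [hE, hE', Nat.cast_zero, sub_zero, ZMod.natCast_eq_natCast_iff, Nat.ModEq] at this
  rwa [Nat.mod_eq_of_lt (E.isDecPart.offset_lt (Finset.mem_univ i)),
    Nat.mod_eq_of_lt (E'.isDecPart.offset_lt (Finset.mem_univ i))] at this

theorem exists_dospFun_eq (hk : 0 < k) (j₀ : Fin n) {f : Fin n → ZMod k} (hf : f j₀ = 0) :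
    ∃ D : DOSP k n, dospFun j₀ D = f := by
  have : NeZero k := ⟨hk.ne'⟩
  obtain ⟨l, hl, hlf⟩ := exists_isDecPart_offset_eq (S := (Finset.univ : Finset (Fin n)))
    ⟨j₀, Finset.mem_univ _⟩ (k := k) (fun i => (f i).val)
    ⟨j₀, Finset.mem_univ _, by simp [hf]⟩ (fun i _ => ZMod.val_lt _)
  have h := (isDecPart_iff _ _ _).1 hl
  refine ⟨Quotient.mk _ ⟨l, h.1, h.2.1, fun i => (h.2.2.1 i).1 (Finset.mem_univ i), h.2.2.2.1,
    h.2.2.2.2⟩, ?_⟩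
  rw [dospFun_mk]
  funext i
  simp [hlf _ (Finset.mem_univ _), hf]

theorem DOSP.isHypersimplicial_iff (j₀ : Fin n) (D : DOSP k n) :
    D.IsHypersimplicial ↔ IsHSFun (fun _ => 1) (dospFun j₀ D) := by
  induction D using Quotient.inductionOn with
  | h D =>
    rw [dospFun_mk]
    simp only [sub_eq_add_neg]
    rw [isHSFun_add_const, D.isDecPart.isHSFun_offset_iff]
    simp only [← Finset.card_eq_sum_ones]
    rfl

theorem offset_act (σ : Equiv.Perm (Fin n)) (l : List (Finset (Fin n) × ℕ)) (i : Fin n) :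
    offset (l.map fun p => (p.1.map σ.toEmbedding, p.2)) i = offset l (σ⁻¹ i) := by
  induction l with
  | nil => rfl
  | cons p l ih =>
    simp only [List.map_cons, offset, Finset.mem_map_equiv, ih]
    rfl

theorem dospFun_smul (j₀ : Fin n) (σ : Equiv.Perm (Fin n)) (D : DOSP k n) (i : Fin n) :
    dospFun j₀ (σ • D) i = dospFun j₀ D (σ⁻¹ i) - dospFun j₀ D (σ⁻¹ j₀) := by
  induction D using Quotient.inductionOn with
  | h D =>
    change dospFun j₀ (Quotient.mk _ (PreDOSP.act σ D)) i = _
    rw [dospFun_mk, dospFun_mk]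
    simp only [PreDOSP.act, offset_act]
    ring

/-- Being fixed means that `f ∘ σ` is a translate of `f`; the normalisation `f j₀ = 0` forces the
translation to be `f (σ j₀)`. -/
theorem smul_eq_iff_dospFun (j₀ : Fin n) (σ : Equiv.Perm (Fin n)) (D : DOSP k n) :
    σ • D = D ↔ ∀ i, dospFun j₀ D (σ i) = dospFun j₀ D i + dospFun j₀ D (σ j₀) := by
  constructor
  · intro hfix i
    have h := dospFun_smul j₀ σ D
    rw [hfix] at h
    have h1 := h (σ i)
    have h2 := h (σ j₀)
    simp only [Equiv.Perm.inv_def, Equiv.symm_apply_apply, dospFun_self] at h1 h2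
    rw [h1, h2]
    ring
  · intro h
    apply dospFun_injective j₀
    funext i
    have h1 := h (σ⁻¹ i)
    have h2 := h (σ⁻¹ j₀)
    have h3 := dospFun_smul j₀ σ D i
    simp only [Equiv.Perm.inv_def, Equiv.apply_symm_apply, dospFun_self] at h1 h2 h3
    rw [h3, h1]
    linear_combination h2

theorem HypersimplicialDOSP.mem_fixedBy_iff (σ : Equiv.Perm (Fin n))
    (D : HypersimplicialDOSP k n) :
    D ∈ MulAction.fixedBy (HypersimplicialDOSP k n) σ ↔ σ • D.val = D.val :=
  ⟨fun h => congrArg Subtype.val h, fun h => Subtype.ext h⟩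

/-- The hypersimplicial DOSPs fixed by `σ`, as functions to `ℤ/k`. -/
noncomputable def fixedByEquiv (hk : 0 < k) (j₀ : Fin n) (σ : Equiv.Perm (Fin n)) :
    MulAction.fixedBy (HypersimplicialDOSP k n) σ ≃
      Σ c : ZMod k, {f : Fin n → ZMod k // f j₀ = 0 ∧ IsHSFun (fun _ => 1) f ∧
        ∀ i, f (σ i) = f i + c} := by
  refine Equiv.ofBijective (fun D => ⟨dospFun j₀ D.1.val (σ j₀), dospFun j₀ D.1.val,
    dospFun_self _ _, (DOSP.isHypersimplicial_iff j₀ _).1 D.1.property,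
    (smul_eq_iff_dospFun j₀ σ _).1 ((HypersimplicialDOSP.mem_fixedBy_iff σ _).1 D.2)⟩) ⟨?_, ?_⟩
  · intro D E h
    exact Subtype.ext (Subtype.ext (dospFun_injective j₀ (congrArg (fun s => s.2.1) h)))
  · rintro ⟨c, f, hf0, hf, hfc⟩
    obtain ⟨D, rfl⟩ := exists_dospFun_eq hk j₀ hf0
    have hc : dospFun j₀ D (σ j₀) = c := by rw [hfc, hf0, zero_add]
    subst hc
    exact ⟨⟨⟨D, (DOSP.isHypersimplicial_iff j₀ D).2 hf⟩, (HypersimplicialDOSP.mem_fixedBy_iff σ _).2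
      ((smul_eq_iff_dospFun j₀ σ D).2 hfc)⟩, rfl⟩

theorem card_fixedBy_eq_sum [NeZero k] (j₀ : Fin n) (σ : Equiv.Perm (Fin n)) :
    Nat.card (MulAction.fixedBy (HypersimplicialDOSP k n) σ) =
      ∑ c : ZMod k, Nat.card {f : Fin n → ZMod k // f j₀ = 0 ∧ IsHSFun (fun _ => 1) f ∧
        ∀ i, f (σ i) = f i + c} := by
  rw [Nat.card_congr (fixedByEquiv (NeZero.pos k) j₀ σ), Nat.card_sigma]

end DOSPFun

/-! ### Cycles of a permutation and functions twisted along them. -/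

section Cycles

variable {α : Type*}

/-- The set of cycles of a permutation, fixed points included. -/
def Cyc (σ : Equiv.Perm α) : Type _ := Quotient (Equiv.Perm.SameCycle.setoid σ)

variable (σ : Equiv.Perm α)

noncomputable instance : DecidableEq (Cyc σ) := Classical.decEq _

/-- The cycle of an element. -/
def Cyc.mk (i : α) : Cyc σ := Quotient.mk _ i

/-- An element of a cycle. -/
noncomputable def Cyc.rep {σ : Equiv.Perm α} (x : Cyc σ) : α := Quotient.out x

noncomputable instance [Fintype α] : Fintype (Cyc σ) :=
  Fintype.ofSurjective (Cyc.mk σ) Quotient.mk_surjective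

/-- The length of a cycle. -/
noncomputable def Cyc.len [Fintype α] {σ : Equiv.Perm α} (x : Cyc σ) : ℕ :=
  (Finset.univ.filter fun i => Cyc.mk σ i = x).card

variable {σ}

theorem Cyc.mk_rep (x : Cyc σ) : Cyc.mk σ x.rep = x := Quotient.out_eq x

theorem Cyc.mk_eq_iff {i j : α} : Cyc.mk σ i = Cyc.mk σ j ↔ σ.SameCycle i j := Quotient.eq

theorem Cyc.mk_apply (i : α) : Cyc.mk σ (σ i) = Cyc.mk σ i :=
  Cyc.mk_eq_iff.2 (Equiv.Perm.sameCycle_apply_left.2 (Equiv.Perm.SameCycle.refl _ _))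

theorem apply_zpow_of_twisted {A : Type*} [AddCommGroup A] {c : A} {f : α → A}
    (hf : ∀ i, f (σ i) = f i + c) (z : ℤ) (i : α) :
    f ((σ ^ z) i) = f i + z • c := by
  induction z using Int.induction_on with
  | zero => simp
  | succ m ih =>
    rw [add_comm, zpow_add, zpow_one, Equiv.Perm.mul_apply, hf, ih, add_zsmul, one_zsmul]
    abel
  | pred m ih =>
    have h : (σ ^ (-(m : ℤ))) i = σ ((σ ^ (-(m : ℤ) - 1)) i) := by
      rw [← Equiv.Perm.mul_apply, ← zpow_one_add]
      congr 2
      ring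
    rw [h, hf] at ih
    rw [eq_sub_of_add_eq ih, sub_zsmul, one_zsmul]
    abel

/-- The number of times that `σ` has to be applied to lead from the representative to `i`. -/
noncomputable def cycExp (σ : Equiv.Perm α) (i : α) : ℤ :=
  (Cyc.mk_eq_iff.1 (Cyc.mk_rep (Cyc.mk σ i))).choose

theorem zpow_cycExp (i : α) : (σ ^ cycExp σ i) (Cyc.mk σ i).rep = i :=
  (Cyc.mk_eq_iff.1 (Cyc.mk_rep (Cyc.mk σ i))).choose_spec

variable [Fintype α]

theorem Cyc.len_pos (x : Cyc σ) : 0 < x.len :=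
  Finset.card_pos.2 ⟨x.rep, by simp [Cyc.mk_rep]⟩

theorem Cyc.sum_filter_len (p : Cyc σ → Prop) [DecidablePred p] :
    ∑ x ∈ Finset.univ.filter p, x.len =
      (Finset.univ.filter fun i => p (Cyc.mk σ i)).card := by
  rw [Finset.card_eq_sum_card_fiberwise (f := Cyc.mk σ) (t := Finset.univ.filter p)
    (by intro i hi; simpa using hi)]
  refine Finset.sum_congr rfl fun x hx => ?_
  rw [Cyc.len, Finset.filter_filter]
  congr 1
  ext i
  simp only [Finset.mem_filter, Finset.mem_univ, true_and] at hx ⊢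
  constructor
  · rintro rfl
    exact ⟨hx, rfl⟩
  · exact fun h => h.2

theorem Cyc.sum_len : ∑ x : Cyc σ, x.len = Fintype.card α := by
  have := Cyc.sum_filter_len (σ := σ) (fun _ => True)
  simpa using this

theorem zpow_apply_eq_self_iff (z : ℤ) (i : α) :
    (σ ^ z) i = i ↔ ((Cyc.mk σ i).len : ℤ) ∣ z := by
  classical
  have h := MulAction.zpow_smul_eq_iff_minimalPeriod_dvd (a := σ) (b := i) (n := z)
  rw [Equiv.Perm.smul_def] at h
  rw [h]
  have : Fintype (MulAction.orbit (Subgroup.zpowers σ) i) := Fintype.ofFinite _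
  rw [MulAction.minimalPeriod_eq_card, Cyc.len, ← Fintype.card_subtype]
  have e : MulAction.orbit (Subgroup.zpowers σ) i ≃ {j // Cyc.mk σ j = Cyc.mk σ i} :=
    Equiv.subtypeEquivRight fun j => by
      rw [Cyc.mk_eq_iff, MulAction.mem_orbit_iff]
      constructor
      · rintro ⟨⟨g, z, rfl⟩, rfl⟩
        exact Equiv.Perm.SameCycle.symm ⟨z, rfl⟩
      · intro hj
        obtain ⟨z, hz⟩ := hj.symm
        exact ⟨⟨σ ^ z, z, rfl⟩, hz⟩
  rw [Fintype.card_congr e]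

section Twisted

variable {A : Type*} [AddCommGroup A] {c : A}

/-- Going once around the cycle returns to the start and adds `c` at each step. -/
theorem len_nsmul_of_twisted {f : α → A} (hf : ∀ i, f (σ i) = f i + c) (x : Cyc σ) :
    x.len • c = 0 := by
  have h := apply_zpow_of_twisted hf (x.len : ℤ) x.rep
  rw [(zpow_apply_eq_self_iff _ _).2 (by rw [Cyc.mk_rep])] at h
  simpa using h

/-- If `c` is killed by all cycle lengths, then the functions with `f (σ i) = f i + c` are
determined by their values at the representatives of the cycles, which are arbitrary. -/
noncomputable def twistedEquiv (σ : Equiv.Perm α) (hc : ∀ x : Cyc σ, x.len • c = 0) :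
    {f : α → A // ∀ i, f (σ i) = f i + c} ≃ (Cyc σ → A) where
  toFun f x := f.1 x.rep
  invFun h := ⟨fun i => h (Cyc.mk σ i) + cycExp σ i • c, fun i => by
    dsimp only
    rw [Cyc.mk_apply]
    -- The chosen exponents for `σ i` and `i` need not differ by one, but they do so modulo the
    -- cycle length, which kills `c`.
    have h1 : (σ ^ (cycExp σ (σ i) - (cycExp σ i + 1))) (Cyc.mk σ i).rep
        = (Cyc.mk σ i).rep := by
      rw [sub_eq_neg_add, zpow_add, Equiv.Perm.mul_apply]
      conv_lhs => rw [← Cyc.mk_apply (σ := σ) i]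
      rw [zpow_cycExp, zpow_neg, Equiv.Perm.inv_eq_iff_eq, add_comm, zpow_add,
        Equiv.Perm.mul_apply, zpow_cycExp, zpow_one]
    rw [zpow_apply_eq_self_iff, Cyc.mk_rep] at h1
    obtain ⟨m, hm⟩ := h1
    have : (cycExp σ (σ i) - (cycExp σ i + 1)) • c = 0 := by
      rw [hm, mul_comm, mul_zsmul, natCast_zsmul, hc, zsmul_zero]
    have h2 := sub_eq_zero.1 ((sub_smul _ _ c).symm.trans this)
    rw [h2, add_smul, one_smul, add_assoc]⟩
  left_inv f := by
    apply Subtype.ext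
    funext i
    have := apply_zpow_of_twisted f.2 (cycExp σ i) (Cyc.mk σ i).rep
    rw [zpow_cycExp] at this
    exact this.symm
  right_inv h := by
    funext x
    have h1 := zpow_cycExp (σ := σ) x.rep
    rw [Cyc.mk_rep, zpow_apply_eq_self_iff, Cyc.mk_rep] at h1
    obtain ⟨m, hm⟩ := h1
    dsimp only
    rw [Cyc.mk_rep, hm, mul_comm, mul_zsmul, natCast_zsmul, hc, zsmul_zero, add_zero]

/-- The permutation `σ ^ z` carries one fibre onto the other. -/
theorem card_fiber_add_zsmul [DecidableEq A] {f : α → A} (hf : ∀ i, f (σ i) = f i + c) (v : A)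
    (z : ℤ) : (Finset.univ.filter fun i => f i = v + z • c).card =
      (Finset.univ.filter fun i => f i = v).card := by
  symm
  refine Finset.card_bij (fun i _ => (σ ^ z) i) ?_ ?_ ?_
  · intro i hi
    simp only [Finset.mem_filter, Finset.mem_univ, true_and] at hi ⊢
    rw [apply_zpow_of_twisted hf, hi]
  · intro i _ j _ h
    exact (σ ^ z).injective h
  · intro j hj
    simp only [Finset.mem_filter, Finset.mem_univ, true_and] at hj
    refine ⟨(σ ^ (-z)) j, ?_, ?_⟩
    · simp only [Finset.mem_filter, Finset.mem_univ, true_and]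
      rw [apply_zpow_of_twisted hf, hj]
      simp
    · rw [← Equiv.Perm.mul_apply, ← zpow_add]
      simp

variable {B : Type*} [AddCommGroup B] [Fintype A] [DecidableEq B] {π : A →+ B}

theorem card_fiber_eq_addOrderOf (hπ : π.ker = AddSubgroup.zmultiples c) (v : A) :
    (Finset.univ.filter fun a => π a = π v).card = addOrderOf c := by
  rw [← Nat.card_zmultiples, ← hπ, ← Nat.card_congr (π.fiberEquivKer v), ← Fintype.card_subtype,
    ← Nat.card_eq_fintype_card]
  rfl

/-- A fibre of `π ∘ f` is the union of the fibres of `f` over a coset of the multiples of `c`, and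
these all have the same size. -/
theorem addOrderOf_mul_card_fiber [DecidableEq A] (hπ : π.ker = AddSubgroup.zmultiples c)
    {f : α → A}
    (hf : ∀ i, f (σ i) = f i + c) (v : A) :
    addOrderOf c * (Finset.univ.filter fun i => f i = v).card =
      (Finset.univ.filter fun i => π (f i) = π v).card := by
  rw [Finset.card_eq_sum_card_fiberwise (s := Finset.univ.filter fun i => π (f i) = π v)
    (f := f) (t := Finset.univ.filter fun a => π a = π v) (by intro i hi; simpa using hi),
    ← card_fiber_eq_addOrderOf hπ v, ← smul_eq_mul, ← Finset.sum_const]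
  refine Finset.sum_congr rfl fun u hu => ?_
  simp only [Finset.mem_filter, Finset.mem_univ, true_and] at hu
  have hmem : u - v ∈ π.ker := by rw [AddMonoidHom.mem_ker, map_sub, hu, sub_self]
  rw [hπ] at hmem
  obtain ⟨z, hz⟩ := AddSubgroup.mem_zmultiples_iff.1 hmem
  obtain rfl : u = v + z • c := by rw [hz]; abel
  rw [← card_fiber_add_zsmul hf v z, Finset.filter_filter]
  congr 1
  ext i
  simp only [Finset.mem_filter, Finset.mem_univ, true_and]
  constructor
  · intro h
    exact ⟨by rw [h, hu], h⟩
  · exact fun h => h.2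

end Twisted

/-- Fibre sizes of `f` equal fibre weights of the reduction by `addOrderOf_mul_card_fiber`. Gaps can
be tested after reduction because `f` takes all values in a coset of the multiples of `c` as soon as
it takes one. -/
theorem isHSFun_iff_of_twisted {k k' : ℕ} [NeZero k] {c : ZMod k} (π : ZMod k →+* ZMod k')
    (hπ : (π : ZMod k →+ ZMod k').ker = AddSubgroup.zmultiples c)
    (hc : ∀ x : Cyc σ, addOrderOf c ∣ x.len) {f : α → ZMod k} (hf : ∀ i, f (σ i) = f i + c) :
    IsHSFun (fun _ => 1) f ↔
      IsHSFun (fun x : Cyc σ => x.len / addOrderOf c) (fun x => π (f x.rep)) := by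
  have hmem : ∀ a, π a = 0 → ∃ z : ℤ, z • c = a := fun a ha => by
    have : a ∈ (π : ZMod k →+ ZMod k').ker := ha
    rw [hπ] at this
    exact AddSubgroup.mem_zmultiples_iff.1 this
  have hcz : ∀ z : ℤ, π (z • c) = 0 := fun z => by
    have : z • c ∈ (π : ZMod k →+ ZMod k').ker := by
      rw [hπ]
      exact AddSubgroup.zsmul_mem_zmultiples c z
    exact this
  have hrep : ∀ i, π (f (Cyc.mk σ i).rep) = π (f i) := fun i => by
    have := apply_zpow_of_twisted hf (cycExp σ i) (Cyc.mk σ i).rep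
    rw [zpow_cycExp] at this
    rw [this, map_add, hcz, add_zero]
  have hpos : 0 < addOrderOf c := addOrderOf_pos c
  have hsum : ∀ v, ∑ i ∈ Finset.univ.filter (fun i => f i = v), 1 =
      ∑ x ∈ Finset.univ.filter (fun x : Cyc σ => π (f x.rep) = π v), x.len / addOrderOf c := by
    intro v
    apply Nat.eq_of_mul_eq_mul_left hpos
    rw [← Finset.card_eq_sum_ones]
    refine (addOrderOf_mul_card_fiber (π := (π : ZMod k →+ ZMod k')) hπ hf v).trans ?_
    rw [Finset.mul_sum, Finset.sum_congr rfl fun x _ => Nat.mul_div_cancel' (hc x),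
      Cyc.sum_filter_len (fun x : Cyc σ => π (f x.rep) = π v)]
    simp only [hrep]
    rfl
  constructor
  · intro H x
    obtain ⟨j, g, hg0, hg, hj⟩ := H x.rep
    rw [hsum] at hg
    refine ⟨Cyc.mk σ j, g, hg0, hg, ?_⟩
    dsimp only
    rw [hrep, hj, map_add, map_natCast]
  · intro H i
    obtain ⟨y, g, hg0, hg, hy⟩ := H (Cyc.mk σ i)
    dsimp only at hg hy
    rw [hrep] at hy
    obtain ⟨z, hz⟩ := hmem (f y.rep - (f i + g)) (by
      rw [map_sub, map_add, map_natCast, hy, sub_self])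
    -- The required equation holds at `y.rep` up to `z • c`; moving back `z` steps along the cycle
    -- removes this error.
    refine ⟨(σ ^ (-z)) y.rep, g, hg0, ?_, ?_⟩
    · rw [hsum]
      simpa only [hrep] using hg
    rw [apply_zpow_of_twisted hf, neg_zsmul, hz]
    abel

end Cycles

/-! ### The number of fixed hypersimplicial DOSPs. -/

section FixedCount

/-- At each point other than `x₀` the value has `addOrderOf c` lifts, chosen independently; at `x₀`
the lift is forced to be `0`. -/
theorem card_lift_eq {R A B : Type*} [Fintype R] [DecidableEq R] [Fintype A] [DecidableEq A]
    [AddCommGroup A] [AddCommGroup B] [Fintype B] [DecidableEq B] {c : A} {π : A →+ B}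
    (hs : Function.Surjective π) (hπ : π.ker = AddSubgroup.zmultiples c) (x₀ : R)
    (P : (R → B) → Prop) :
    Nat.card {h : R → A // h x₀ = 0 ∧ P fun x => π (h x)} =
      addOrderOf c ^ (Fintype.card R - 1) * Nat.card {b : R → B // b x₀ = 0 ∧ P b} := by
  classical
  rw [Nat.card_eq_fintype_card, Nat.card_eq_fintype_card, Fintype.card_subtype,
    Fintype.card_subtype, Finset.card_eq_sum_card_fiberwise (f := fun h x => π (h x))
      (t := Finset.univ.filter fun b : R → B => b x₀ = 0 ∧ P b), mul_comm, ← smul_eq_mul,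
    ← Finset.sum_const]
  · refine Finset.sum_congr rfl fun b hb => ?_
    simp only [Finset.mem_filter, Finset.mem_univ, true_and] at hb
    have hset : (Finset.univ.filter fun h : R → A => h x₀ = 0 ∧ P fun x => π (h x)).filter
        (fun h => (fun x => π (h x)) = b) = Fintype.piFinset fun x =>
          if x = x₀ then {0} else Finset.univ.filter fun a => π a = b x := by
      ext h
      simp only [Finset.mem_filter, Finset.mem_univ, true_and, Fintype.mem_piFinset]
      constructor
      · rintro ⟨⟨h0, -⟩, rfl⟩ x
        split_ifs with hx
        · simp [hx, h0]
        · simp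
      · intro H
        have h0 : h x₀ = 0 := by simpa using H x₀
        have hb' : (fun x => π (h x)) = b := by
          funext x
          by_cases hx : x = x₀
          · rw [hx, h0, hb.1, map_zero]
          · simpa [hx] using H x
        exact ⟨⟨h0, by rw [hb']; exact hb.2⟩, hb'⟩
    rw [hset, Fintype.card_piFinset, ← Finset.mul_prod_erase _ _ (Finset.mem_univ x₀), if_pos rfl,
      Finset.card_singleton, one_mul, ← Finset.card_univ,
      ← Finset.card_erase_of_mem (Finset.mem_univ x₀), ← Finset.prod_const]
    refine Finset.prod_congr rfl fun x hx => ?_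
    rw [if_neg (Finset.ne_of_mem_erase hx)]
    obtain ⟨v, hv⟩ := hs (b x)
    rw [← hv]
    exact card_fiber_eq_addOrderOf hπ v
  · intro h hh
    simp only [Finset.coe_filter, Finset.mem_univ, true_and, Set.mem_ofPred_eq] at hh ⊢
    exact ⟨by rw [hh.1, map_zero], hh.2⟩

theorem weightPoly_mul {R : Type*} [Fintype R] (w : R → ℕ) (e : ℕ) :
    weightPoly (fun x => e * w x) = Polynomial.expand ℤ e (weightPoly w) := by
  simp [weightPoly, pow_mul]

/-- Only exponents `e * h` occur, with the unscaled coefficients, and `(e k - e h)^r` yields the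
factor `e^r`. -/
theorem sum_weightPoly_mul {R : Type*} [Fintype R] (w : R → ℕ) {e : ℕ} (he : 0 < e) (k r : ℕ) :
    ∑ h ∈ Finset.range (e * k),
        (weightPoly fun x => e * w x).coeff h * (((e * k : ℕ) : ℤ) - h) ^ r =
      (e : ℤ) ^ r * ∑ h ∈ Finset.range k, (weightPoly w).coeff h * ((k : ℤ) - h) ^ r := by
  rw [Finset.mul_sum]
  have hinj : Set.InjOn (fun h => e * h) (Finset.range k : Set ℕ) := fun a _ b _ h =>
    Nat.eq_of_mul_eq_mul_left he h
  have hsub : (Finset.range k).image (fun h => e * h) ⊆ Finset.range (e * k) := by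
    intro h hh
    obtain ⟨a, ha, rfl⟩ := Finset.mem_image.1 hh
    exact Finset.mem_range.2 (Nat.mul_lt_mul_of_pos_left (Finset.mem_range.1 ha) he)
  rw [← Finset.sum_subset hsub, Finset.sum_image hinj]
  · refine Finset.sum_congr rfl fun h _ => ?_
    rw [weightPoly_mul, mul_comm e h, Polynomial.coeff_expand_mul he]
    push_cast
    rw [show (e : ℤ) * k - h * e = e * (k - h) by ring, mul_pow]
    ring
  · intro h hh hn
    rw [weightPoly_mul, Polynomial.coeff_expand he, if_neg, zero_mul]
    rintro ⟨a, rfl⟩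
    exact hn (Finset.mem_image_of_mem _ (Finset.mem_range.2
      (Nat.lt_of_mul_lt_mul_left (Finset.mem_range.1 hh))))

variable {α : Type*} [Fintype α] {σ : Equiv.Perm α}

/-- Reduction mod `k' = k / addOrderOf c` kills `c`, and its kernel has exactly `addOrderOf c`
elements. -/
theorem exists_ringHom_ker_eq_zmultiples {k : ℕ} [NeZero k] (c : ZMod k) :
    ∃ k', k = addOrderOf c * k' ∧ 0 < k' ∧ ∃ π : ZMod k →+* ZMod k', Function.Surjective π ∧
      (π : ZMod k →+ ZMod k').ker = AddSubgroup.zmultiples c := by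
  have hdvd : addOrderOf c ∣ k := by
    have := addOrderOf_dvd_card (x := c)
    rwa [ZMod.card] at this
  obtain ⟨k', hk'⟩ := hdvd
  have hk0 : 0 < addOrderOf c * k' := hk' ▸ NeZero.pos k
  have he : 0 < addOrderOf c := Nat.pos_of_mul_pos_right hk0
  have hk'0 : 0 < k' := Nat.pos_of_mul_pos_left hk0
  have hd : k' ∣ k := ⟨_, hk'.trans (mul_comm _ _)⟩
  have : NeZero k' := ⟨hk'0.ne'⟩
  have hs : Function.Surjective (ZMod.castHom hd (ZMod k')) := ZMod.castHom_surjective hd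
  refine ⟨k', hk', hk'0, ZMod.castHom hd (ZMod k'), hs, ?_⟩
  symm
  apply AddSubgroup.eq_of_le_of_card_ge
  · rw [AddSubgroup.zmultiples_le]
    change ZMod.castHom hd (ZMod k') c = 0
    have h1 : addOrderOf c • c = 0 := addOrderOf_nsmul_eq_zero c
    rw [← ZMod.natCast_zmod_val c, nsmul_eq_mul, ← Nat.cast_mul, ZMod.natCast_eq_zero_iff] at h1
    rw [ZMod.natCast_zmod_val c] at h1
    nth_rewrite 1 [hk'] at h1
    rw [← ZMod.natCast_zmod_val c, map_natCast, ZMod.natCast_eq_zero_iff]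
    exact Nat.dvd_of_mul_dvd_mul_left he h1
  · rw [Nat.card_zmultiples]
    have h1 := AddSubgroup.card_mul_index (ZMod.castHom hd (ZMod k') : ZMod k →+ ZMod k').ker
    rw [AddSubgroup.index_ker, AddMonoidHom.range_eq_top.2 hs, AddSubgroup.card_top, Nat.card_zmod,
      Nat.card_zmod] at h1
    exact (Nat.eq_of_mul_eq_mul_right hk'0 (h1.trans hk')).le

/-- The answer does not depend on `c`: the number of lifts from `ZMod k'` is exactly the factor
gained by rescaling the weights `len / addOrderOf c` back to `len`. -/
theorem card_twisted_isHSFun {k : ℕ} [NeZero k] (hk : k < Fintype.card α) (x₀ : Cyc σ) (c : ZMod k)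
    (hc : ∀ x : Cyc σ, x.len • c = 0) :
    (Nat.card {f : α → ZMod k // f x₀.rep = 0 ∧ IsHSFun (fun _ => 1) f ∧
      ∀ i, f (σ i) = f i + c} : ℤ) = ∑ h ∈ Finset.range k,
        (weightPoly (Cyc.len (σ := σ))).coeff h * ((k : ℤ) - h) ^ (Fintype.card (Cyc σ) - 1) := by
  obtain ⟨k', hk', hk'0, π, hs, hπ⟩ := exists_ringHom_ker_eq_zmultiples c
  have he : 0 < addOrderOf c := addOrderOf_pos c
  have hdvd : ∀ x : Cyc σ, addOrderOf c ∣ x.len := fun x =>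
    addOrderOf_dvd_iff_nsmul_eq_zero.2 (hc x)
  have hmul : ∀ x : Cyc σ, addOrderOf c * (x.len / addOrderOf c) = x.len := fun x =>
    Nat.mul_div_cancel' (hdvd x)
  have : NeZero k' := ⟨hk'0.ne'⟩
  let E : {f : α → ZMod k // f x₀.rep = 0 ∧ IsHSFun (fun _ => 1) f ∧ ∀ i, f (σ i) = f i + c} ≃
      {h : Cyc σ → ZMod k // h x₀ = 0 ∧
        IsHSFun (fun x : Cyc σ => x.len / addOrderOf c) fun x => π (h x)} :=
    { toFun := fun f => ⟨fun x => f.1 x.rep, f.2.1,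
        (isHSFun_iff_of_twisted π hπ hdvd f.2.2.2).1 f.2.2.1⟩
      invFun := fun h => ⟨((twistedEquiv σ hc).symm h.1).1, by
        have h1 : ∀ x : Cyc σ, ((twistedEquiv σ hc).symm h.1).1 x.rep = h.1 x :=
          congrFun ((twistedEquiv σ hc).apply_symm_apply h.1)
        refine ⟨(h1 x₀).trans h.2.1, ?_, ((twistedEquiv σ hc).symm h.1).2⟩
        rw [isHSFun_iff_of_twisted π hπ hdvd ((twistedEquiv σ hc).symm h.1).2]
        simp only [h1]
        exact h.2.2⟩
      left_inv := fun f => Subtype.ext (by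
        have h1 := congrArg Subtype.val
          ((twistedEquiv σ hc).symm_apply_apply ⟨f.1, f.2.2.2⟩)
        exact h1)
      right_inv := fun h => Subtype.ext ((twistedEquiv σ hc).apply_symm_apply h.1) }
  have hsum : k' < ∑ x : Cyc σ, x.len / addOrderOf c := by
    apply Nat.lt_of_mul_lt_mul_left (a := addOrderOf c)
    rw [Finset.mul_sum, ← hk', Finset.sum_congr rfl fun x _ => hmul x, Cyc.sum_len]
    exact hk
  have hcard := card_lift_eq (π := (π : ZMod k →+ ZMod k')) hs hπ x₀
    (IsHSFun fun x : Cyc σ => x.len / addOrderOf c)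
  have hcount := card_isHSFun (fun x : Cyc σ => x.len / addOrderOf c)
    (fun x => Nat.div_pos (Nat.le_of_dvd x.len_pos (hdvd x)) he) x₀ hk'0 hsum
  have hscale := sum_weightPoly_mul (fun x : Cyc σ => x.len / addOrderOf c) he k'
    (Fintype.card (Cyc σ) - 1)
  simp only [hmul, ← hk'] at hscale
  rw [hscale, ← hcount, Nat.card_congr E]
  refine (congrArg Nat.cast hcard).trans ?_
  push_cast
  rfl

/-- An element is killed by all weights exactly when it is killed by their gcd, and multiplication
by `G` on a cyclic group of order `k` has kernel of size `gcd(k, G)`. -/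
theorem card_nsmul_eq_zero_forall (k : ℕ) [NeZero k] {R : Type*} [Fintype R] (w : R → ℕ) :
    (Finset.univ.filter fun c : ZMod k => ∀ x, w x • c = 0).card =
      k.gcd (Finset.univ.gcd w) := by
  have h := IsAddCyclic.card_nsmulAddMonoidHom_ker (G := ZMod k) (Finset.univ.gcd w)
  rw [Nat.card_zmod] at h
  rw [← h, ← Fintype.card_subtype, ← Nat.card_eq_fintype_card]
  refine Nat.card_congr (Equiv.subtypeEquivRight fun c => ?_)
  rw [AddMonoidHom.mem_ker, nsmulAddMonoidHom_apply, ← addOrderOf_dvd_iff_nsmul_eq_zero,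
    Finset.dvd_gcd_iff]
  simp [addOrderOf_dvd_iff_nsmul_eq_zero]

theorem card_fixedBy_hypersimplicialDOSP {k n : ℕ} (hk : 0 < k) (hkn : k < n)
    (σ : Equiv.Perm (Fin n)) :
    (Nat.card (MulAction.fixedBy (HypersimplicialDOSP k n) σ) : ℤ) =
      (k.gcd (Finset.univ.gcd (Cyc.len (σ := σ))) : ℕ) * ∑ h ∈ Finset.range k,
        (weightPoly (Cyc.len (σ := σ))).coeff h * ((k : ℤ) - h) ^ (Fintype.card (Cyc σ) - 1) := by
  have : NeZero k := ⟨hk.ne'⟩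
  have x₀ : Cyc σ := Cyc.mk σ ⟨0, by omega⟩
  rw [card_fixedBy_eq_sum x₀.rep σ, ← card_nsmul_eq_zero_forall, ← nsmul_eq_mul,
    ← Finset.sum_const, Finset.sum_filter]
  push_cast
  refine Finset.sum_congr rfl fun c _ => ?_
  split_ifs with hc
  · exact card_twisted_isHSFun (by simpa using hkn) x₀ c hc
  · rw [Nat.cast_eq_zero, Nat.card_eq_zero]
    exact Or.inl ⟨fun f => hc fun x => len_nsmul_of_twisted f.2.2.2 x⟩

end FixedCount

/-! ### The numerator of the Ehrhart series and its value at `1`. -/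

section EhrhartSeries

open PowerSeries

variable {R : Type*} [Fintype R]

/-- The polynomial `∏_x (1 + t ^ w x + ⋯ + t ^ ((M - 1) w x))`. -/
noncomputable def boxPoly (w : R → ℕ) (M : ℕ) : Polynomial ℤ :=
  ∏ x, ∑ a ∈ Finset.range M, Polynomial.X ^ (w x * a)

theorem boxPoly_mul_weightPoly (w : R → ℕ) (M : ℕ) :
    boxPoly w M * weightPoly w = Polynomial.expand ℤ M (weightPoly w) := by
  rw [boxPoly, weightPoly, ← Finset.prod_mul_distrib, map_prod]
  refine Finset.prod_congr rfl fun x _ => ?_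
  simp only [pow_mul]
  rw [geom_sum_mul_neg]
  simp [← pow_mul, mul_comm]

theorem boxPoly_eq_sum [DecidableEq R] (w : R → ℕ) (M : ℕ) :
    boxPoly w M = ∑ y ∈ Fintype.piFinset fun _ : R => Finset.range M,
      Polynomial.X ^ (∑ x, w x * y x) := by
  rw [boxPoly, Finset.prod_univ_sum]
  exact Finset.sum_congr rfl fun y _ => Finset.prod_pow_eq_pow_sum _ _ _

/-- The power series of the coefficients whose index is a multiple of `d`. -/
noncomputable def sectionSeries (d : ℕ) (G : ℤ⟦X⟧) : ℤ⟦X⟧ := PowerSeries.mk fun m => coeff (d * m) G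

/-- A factor in `t^d` passes through the extraction of every `d`-th coefficient. -/
theorem sectionSeries_mul {d : ℕ} (hd : 0 < d) (G : ℤ⟦X⟧) (K : Polynomial ℤ) :
    sectionSeries d G * (K : ℤ⟦X⟧) =
      sectionSeries d (G * (Polynomial.expand ℤ d K : Polynomial ℤ)) := by
  induction K using Polynomial.induction_on' with
  | add p q hp hq =>
    rw [Polynomial.coe_add, mul_add, hp, hq, map_add, Polynomial.coe_add, mul_add]
    ext m
    simp [sectionSeries]
  | monomial j a =>
    ext m
    rw [Polynomial.expand_monomial]
    simp only [← Polynomial.C_mul_X_pow_eq_monomial,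
      Polynomial.coe_mul, Polynomial.coe_C, Polynomial.coe_pow, Polynomial.coe_X, sectionSeries,
      coeff_mk]
    rw [← mul_assoc, ← mul_assoc, coeff_mul_X_pow', coeff_mul_X_pow']
    simp only [coeff_mul_C, coeff_mk]
    rw [mul_comm j d]
    by_cases h : j ≤ m
    · rw [if_pos h, if_pos (Nat.mul_le_mul_left d h), Nat.mul_sub]
    · rw [if_neg h, if_neg fun h' => h (Nat.le_of_mul_le_mul_left h' hd)]

theorem sectionSeries_coe {d : ℕ} (hd : 0 < d) (p : Polynomial ℤ) :
    sectionSeries d (p : ℤ⟦X⟧) = (Polynomial.contract d p : Polynomial ℤ) := by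
  ext m
  rw [sectionSeries, coeff_mk, Polynomial.coeff_coe, Polynomial.coeff_coe,
    Polynomial.coeff_contract hd.ne', mul_comm]

theorem constantCoeff_weightPoly {w : R → ℕ} (hw : ∀ x, 0 < w x) :
    constantCoeff (weightPoly w : ℤ⟦X⟧) = 1 := by
  rw [← coeff_zero_eq_constantCoeff_apply, Polynomial.coeff_coe, Polynomial.coeff_zero_eq_eval_zero,
    weightPoly, Polynomial.eval_prod]
  exact Finset.prod_eq_one fun x _ => by simp [(hw x).ne']

/-- The numerator of the Ehrhart series of the weighted hypersimplex. -/
noncomputable def numeratorPoly (w : R → ℕ) (k : ℕ) : Polynomial ℤ :=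
  ∑ h ∈ Finset.range k, Polynomial.C ((weightPoly w).coeff h) *
    Polynomial.contract (k - h) (Polynomial.X ^ h * boxPoly w (k - h))

/-- With `F = 1/W`, the box polynomial is `W(t^(m+1)) F`, so its coefficient at `km` is `∑_h W_h`
times the coefficient of `F` at `km - h(m+1) = (k-h)m - h`. This is a section of `t^h F` with step
`d = k-h`. Multiplying by `W(t)` replaces `F` by `W(t^d) F`, the box polynomial with `M = d`, so
each term becomes a polynomial. -/
theorem mk_boxPoly_mul_weightPoly {w : R → ℕ} (hw : ∀ x, 0 < w x) {k : ℕ} (hk : 0 < k) :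
    (PowerSeries.mk fun m => (boxPoly w (m + 1)).coeff (k * m)) * (weightPoly w : ℤ⟦X⟧) =
      (numeratorPoly w k : ℤ⟦X⟧) := by
  obtain ⟨F, hF⟩ : ∃ F, (weightPoly w : ℤ⟦X⟧) * F = 1 := by
    have : IsUnit (weightPoly w : ℤ⟦X⟧) := by
      rw [PowerSeries.isUnit_iff_constantCoeff, constantCoeff_weightPoly hw]
      exact isUnit_one
    exact this.exists_right_inv
  have hbox : ∀ M, (boxPoly w M : ℤ⟦X⟧) =
      (Polynomial.expand ℤ M (weightPoly w) : Polynomial ℤ) * F :=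
    fun M => by
      rw [← boxPoly_mul_weightPoly, Polynomial.coe_mul, mul_assoc, hF, mul_one]
  have hexp : ∀ M, ((Polynomial.expand ℤ M (weightPoly w) : Polynomial ℤ) : ℤ⟦X⟧) =
      ∑ h ∈ Finset.range (k + (weightPoly w).natDegree + 1),
        C ((weightPoly w).coeff h) * X ^ (h * M) := fun M => by
    have h1 := Polynomial.as_sum_range' (weightPoly w) (k + (weightPoly w).natDegree + 1) (by omega)
    conv_lhs => rw [h1]
    rw [map_sum, ← Polynomial.coeToPowerSeries.ringHom_apply, map_sum]
    refine Finset.sum_congr rfl fun h _ => ?_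
    rw [Polynomial.expand_monomial, Polynomial.coeToPowerSeries.ringHom_apply,
      ← Polynomial.C_mul_X_pow_eq_monomial, Polynomial.coe_mul, Polynomial.coe_C,
      Polynomial.coe_pow, Polynomial.coe_X]
  have hseries : (PowerSeries.mk fun m => (boxPoly w (m + 1)).coeff (k * m)) =
      ∑ h ∈ Finset.range k, C ((weightPoly w).coeff h) * sectionSeries (k - h) (X ^ h * F) := by
    ext m
    rw [coeff_mk, ← Polynomial.coeff_coe, hbox, hexp, Finset.sum_mul, map_sum, map_sum]
    have hsub : Finset.range k ⊆ Finset.range (k + (weightPoly w).natDegree + 1) :=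
      Finset.range_subset_range.2 (by omega)
    rw [← Finset.sum_subset hsub]
    · refine Finset.sum_congr rfl fun h hh => ?_
      have hh' := Finset.mem_range.1 hh
      rw [mul_assoc, coeff_C_mul, coeff_C_mul, sectionSeries, coeff_mk, coeff_X_pow_mul',
        coeff_X_pow_mul']
      have h1 : h * (m + 1) = h * m + h := by ring
      have h2 : (k - h) * m = k * m - h * m := Nat.sub_mul _ _ _
      have h3 : h * m ≤ k * m := Nat.mul_le_mul_right m hh'.le
      by_cases hc : h ≤ (k - h) * m
      · rw [if_pos hc, if_pos (by omega)]
        congr 3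
        omega
      · rw [if_neg hc, if_neg (by omega)]
    -- For `h ≥ k` the exponent `h (m + 1)` already exceeds `k m`.
    · intro h _ hn
      have hkh : k ≤ h := by simpa using hn
      rw [mul_assoc, coeff_C_mul, coeff_X_pow_mul', if_neg, mul_zero]
      have h1 := Nat.mul_le_mul_right (m + 1) hkh
      have h2 : k * (m + 1) = k * m + k := by ring
      omega
  rw [hseries, Finset.sum_mul, numeratorPoly,
    ← Polynomial.coeToPowerSeries.ringHom_apply (φ := ∑ h ∈ _, _), map_sum]
  refine Finset.sum_congr rfl fun h hh => ?_
  have hd : 0 < k - h := Nat.sub_pos_of_lt (Finset.mem_range.1 hh)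
  rw [Polynomial.coeToPowerSeries.ringHom_apply, Polynomial.coe_mul, Polynomial.coe_C, mul_assoc,
    sectionSeries_mul hd, ← sectionSeries_coe hd, Polynomial.coe_mul, Polynomial.coe_pow,
    Polynomial.coe_X, hbox, mul_assoc, mul_comm F]

theorem contract_X_pow_eval_one {d : ℕ} (hd : 0 < d) (N : ℕ) :
    (Polynomial.contract d (Polynomial.X ^ N : Polynomial ℤ)).eval 1 = if d ∣ N then 1 else 0 := by
  split_ifs with h
  · obtain ⟨q, rfl⟩ := h
    have : (Polynomial.X ^ (d * q) : Polynomial ℤ) = Polynomial.expand ℤ d (Polynomial.X ^ q) := by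
      simp [pow_mul]
    rw [this, Polynomial.contract_expand _ hd.ne']
    simp
  · have : Polynomial.contract d (Polynomial.X ^ N : Polynomial ℤ) = 0 := by
      ext m
      rw [Polynomial.coeff_contract hd.ne', Polynomial.coeff_X_pow, if_neg, Polynomial.coeff_zero]
      rintro rfl
      exact h (Dvd.intro_left _ rfl)
    rw [this, Polynomial.eval_zero]

theorem contract_sum_eval_one {ι : Type*} {d : ℕ} (hd : 0 < d) (s : Finset ι)
    (p : ι → Polynomial ℤ) : (Polynomial.contract d (∑ i ∈ s, p i)).eval 1 =
      ∑ i ∈ s, (Polynomial.contract d (p i)).eval 1 := by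
  classical
  induction s using Finset.induction_on with
  | empty =>
    have : Polynomial.contract d (0 : Polynomial ℤ) = 0 := by
      ext m
      rw [Polynomial.coeff_contract hd.ne']
      simp
    simp [this]
  | insert a s ha ih =>
    rw [Finset.sum_insert ha, Finset.sum_insert ha, Polynomial.contract_add hd.ne',
      Polynomial.eval_add, ih]

/-- The homomorphism `y ↦ ∑ w x • y x`. -/
def weightHom (w : R → ℕ) (d : ℕ) : (R → ZMod d) →+ ZMod d where
  toFun y := ∑ x, w x • y x
  map_zero' := by simp
  map_add' y z := by simp [Finset.sum_add_distrib]

/-- Bézout in subgroup form: the preimage of the range in `ℤ` is generated by one integer, which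
divides every weight and hence their gcd. -/
theorem weightHom_range [DecidableEq R] (w : R → ℕ) (d : ℕ) [NeZero d] :
    (weightHom w d).range = AddSubgroup.zmultiples ((Finset.univ.gcd w : ℕ) : ZMod d) := by
  apply le_antisymm
  · rintro _ ⟨y, rfl⟩
    refine AddSubgroup.sum_mem _ fun x _ => ?_
    obtain ⟨a, ha⟩ := Finset.gcd_dvd (f := w) (Finset.mem_univ x)
    refine AddSubgroup.mem_zmultiples_iff.2 ⟨(a : ℤ) * ((y x).val : ℤ), ?_⟩
    rw [ha]
    simp only [nsmul_eq_mul, zsmul_eq_mul]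
    push_cast
    rw [ZMod.natCast_zmod_val]
    ring
  · rw [AddSubgroup.zmultiples_le]
    obtain ⟨a, ha⟩ := Int.subgroup_cyclic ((weightHom w d).range.comap (Int.castAddHom (ZMod d)))
    have hmem : ∀ z : ℤ, (z : ZMod d) ∈ (weightHom w d).range ↔ a ∣ z := fun z => by
      rw [← Int.mem_zmultiples_iff, AddSubgroup.zmultiples_eq_closure, ← ha]
      rfl
    have hw : ∀ x, a ∣ (w x : ℤ) := fun x => by
      rw [← hmem]
      refine ⟨Pi.single x 1, ?_⟩
      change ∑ y, w y • (Pi.single x (1 : ZMod d) : R → ZMod d) y = _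
      rw [Finset.sum_eq_single x]
      · simp
      · intro y _ hy
        simp [hy]
      · simp
    have h := (hmem ((Finset.univ.gcd w : ℕ) : ℤ)).2 (by
      rw [← Int.natAbs_dvd_natAbs, Int.natAbs_natCast]
      refine Finset.dvd_gcd fun x _ => ?_
      simpa using Int.natAbs_dvd_natAbs.2 (hw x))
    simpa using h

/-- The divisibility makes the fibre nonempty, hence a coset of the kernel; the range has `d /
gcd(d, G)` elements, where `G` is the gcd of the weights. -/
theorem card_weightHom_fiber [DecidableEq R] [Nonempty R] (w : R → ℕ) {d : ℕ} [NeZero d] {h : ℕ}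
    (hh : d.gcd (Finset.univ.gcd w) ∣ h) :
    Nat.card {y : R → ZMod d // weightHom w d y = -(h : ZMod d)} =
      d.gcd (Finset.univ.gcd w) * d ^ (Fintype.card R - 1) := by
  set G := Finset.univ.gcd w with hG
  have hd : 0 < d := NeZero.pos d
  have hmem : -(h : ZMod d) ∈ (weightHom w d).range := by
    rw [weightHom_range, neg_mem_iff, AddSubgroup.mem_zmultiples_iff]
    obtain ⟨q, rfl⟩ := hh
    refine ⟨d.gcdB G * q, ?_⟩
    have hb := congrArg (Int.cast : ℤ → ZMod d) (Nat.gcd_eq_gcd_ab d G)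
    push_cast at hb
    rw [ZMod.natCast_self, zero_mul, zero_add] at hb
    push_cast
    rw [hb, zsmul_eq_mul]
    push_cast
    ring
  obtain ⟨y₀, hy₀⟩ := hmem
  have hker : Nat.card {y : R → ZMod d // weightHom w d y = -(h : ZMod d)} =
      Nat.card (weightHom w d).ker := by
    rw [← hy₀]
    exact Nat.card_congr ((weightHom w d).fiberEquivKer y₀)
  have hcard := AddSubgroup.card_mul_index (weightHom w d).ker
  rw [AddSubgroup.index_ker, weightHom_range, Nat.card_zmultiples, ZMod.addOrderOf_coe _ hd.ne',
    Nat.card_fun, Nat.card_zmod, Nat.card_eq_fintype_card (α := R)] at hcard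
  rw [hker]
  have hgd : d.gcd G ∣ d := Nat.gcd_dvd_left d G
  have hq : 0 < d / d.gcd G := Nat.div_pos (Nat.le_of_dvd hd hgd) (Nat.gcd_pos_of_pos_left _ hd)
  apply Nat.eq_of_mul_eq_mul_right hq
  rw [hcard, mul_right_comm, Nat.mul_div_cancel' hgd, ← pow_succ',
    Nat.sub_add_cancel Fintype.card_pos]

/-- Contracting and setting `t = 1` counts the monomials with exponent divisible by `d`, that is,
the `y` in `{0, …, d-1}^R` with `h + ∑ w x * y x ≡ 0` mod `d`. -/
theorem contract_boxPoly_eval_one [DecidableEq R] [Nonempty R] (w : R → ℕ) {d : ℕ} (hd : 0 < d)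
    {h : ℕ} (hh : d.gcd (Finset.univ.gcd w) ∣ h) :
    (Polynomial.contract d (Polynomial.X ^ h * boxPoly w d)).eval 1 =
      ((d.gcd (Finset.univ.gcd w) * d ^ (Fintype.card R - 1) : ℕ) : ℤ) := by
  have : NeZero d := ⟨hd.ne'⟩
  rw [boxPoly_eq_sum, Finset.mul_sum, contract_sum_eval_one hd]
  simp only [← pow_add, contract_X_pow_eval_one hd]
  rw [Finset.sum_boole, ← card_weightHom_fiber w hh, Nat.card_eq_fintype_card,
    Fintype.card_subtype]
  congr 1
  have hval : ∀ y : R → ℕ, d ∣ h + ∑ x, w x * y x ↔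
      weightHom w d (fun x => (y x : ZMod d)) = -(h : ZMod d) := fun y => by
    rw [← ZMod.natCast_eq_zero_iff, eq_neg_iff_add_eq_zero, add_comm]
    simp [weightHom]
  refine Finset.card_bij' (fun y _ x => (y x : ZMod d)) (fun z _ x => (z x).val) ?_ ?_ ?_ ?_
  · intro y hy
    rw [Finset.mem_filter] at hy ⊢
    exact ⟨Finset.mem_univ _, (hval y).1 hy.2⟩
  · intro z hz
    rw [Finset.mem_filter] at hz ⊢
    refine ⟨Fintype.mem_piFinset.2 fun x => Finset.mem_range.2 (ZMod.val_lt _), (hval _).2 ?_⟩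
    simpa using hz.2
  · intro y hy
    funext x
    rw [Finset.mem_filter, Fintype.mem_piFinset] at hy
    exact ZMod.val_cast_of_lt (Finset.mem_range.1 (hy.1 x))
  · intro z _
    funext x
    simp

theorem dvd_of_weightPoly_coeff_ne_zero (w : R → ℕ) (hw : ∀ x, 0 < w x) [Nonempty R] {h : ℕ}
    (hh : (weightPoly w).coeff h ≠ 0) : Finset.univ.gcd w ∣ h := by
  by_contra hn
  apply hh
  have hG : 0 < Finset.univ.gcd w := by
    obtain ⟨x⟩ := ‹Nonempty R›
    exact Nat.pos_of_dvd_of_pos (Finset.gcd_dvd (Finset.mem_univ x)) (hw x)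
  have : w = fun x => Finset.univ.gcd w * (w x / Finset.univ.gcd w) := by
    funext x
    exact (Nat.mul_div_cancel' (Finset.gcd_dvd (Finset.mem_univ x))).symm
  rw [this, weightPoly_mul, Polynomial.coeff_expand hG, if_neg hn]

theorem numeratorPoly_eval_one [DecidableEq R] [Nonempty R] {w : R → ℕ} (hw : ∀ x, 0 < w x)
    (k : ℕ) : (numeratorPoly w k).eval 1 = (k.gcd (Finset.univ.gcd w) : ℕ) *
      ∑ h ∈ Finset.range k, (weightPoly w).coeff h * ((k : ℤ) - h) ^ (Fintype.card R - 1) := by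
  rw [numeratorPoly, Polynomial.eval_finsetSum, Finset.mul_sum]
  refine Finset.sum_congr rfl fun h hh => ?_
  have hhk := Finset.mem_range.1 hh
  rw [Polynomial.eval_mul, Polynomial.eval_C]
  by_cases h0 : (weightPoly w).coeff h = 0
  · simp [h0]
  · have hdvd := dvd_of_weightPoly_coeff_ne_zero w hw h0
    -- A nonzero coefficient forces the gcd of the weights to divide `h`, so the factor is the same
    -- for every `h` and can be pulled out of the sum.
    have hgcd : (k - h).gcd (Finset.univ.gcd w) = k.gcd (Finset.univ.gcd w) := by
      obtain ⟨q, hq⟩ := hdvd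
      rw [hq]
      exact Nat.gcd_sub_mul_left_left (hq ▸ hhk.le)
    rw [contract_boxPoly_eval_one w (Nat.sub_pos_of_lt hhk)
      ((Nat.gcd_dvd_right _ _).trans hdvd), hgcd]
    push_cast [Nat.cast_sub hhk.le]
    ring

end EhrhartSeries

/-! ### Permutation characters count fixed points. -/

section Character

theorem permCharacter_apply {G X : Type*} [Group G] [MulAction G X] [Finite X] (g : G) :
    permCharacter G X g = (Nat.card (MulAction.fixedBy X g) : ℂ) := by
  classical
  have := Fintype.ofFinite X
  rw [permCharacter, Representation.character,
    LinearMap.trace_eq_matrix_trace ℂ (MonoidAlgebra.basis X ℂ), Matrix.trace]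
  have h : ∀ x, (LinearMap.toMatrix (MonoidAlgebra.basis X ℂ) (MonoidAlgebra.basis X ℂ)
      (Representation.ofMulAction ℂ G X g)).diag x = if g • x = x then 1 else 0 := fun x => by
    rw [Matrix.diag_apply, LinearMap.toMatrix_apply, MonoidAlgebra.basis_apply,
      Representation.ofMulAction_single]
    exact Finsupp.single_apply
  simp only [h]
  rw [Finset.sum_boole, Nat.card_eq_fintype_card, Fintype.card_subtype]
  rfl

end Character

/-! ### The determinant as a product over cycles. -/

section Det

open Polynomial

variable {β : Type*} [DecidableEq β]

theorem one_sub_X_smul_permMatrix_apply (s : Equiv.Perm β) (i j : β) :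
    (1 - (X : ℤ[X]) • (s⁻¹.permMatrix ℤ).map C) i j =
      (if i = j then 1 else 0) - if i = s j then X else 0 := by
  rw [Matrix.sub_apply, Matrix.smul_apply, Matrix.map_apply, Matrix.one_apply,
    Equiv.Perm.permMatrix, PEquiv.toMatrix_apply]
  have : (j ∈ (Equiv.toPEquiv s⁻¹) i) ↔ i = s j := by
    rw [Equiv.toPEquiv_apply, Option.mem_some_iff, Equiv.Perm.inv_eq_iff_eq]
  simp only [this]
  split_ifs <;> simp

variable [Fintype β]

/-- If `τ` fixes `j`, injectivity forbids `τ (s⁻¹ j) = j` unless `s⁻¹ j = j`, so `τ` fixes `s⁻¹ j`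
as well. One fixed point thus spreads around the whole cycle. -/
theorem eq_one_or_eq_of_forall_sameCycle {s : Equiv.Perm β} (hs : ∀ i j, s.SameCycle i j)
    {τ : Equiv.Perm β} (hτ : ∀ i, τ i = i ∨ τ i = s i) : τ = 1 ∨ τ = s := by
  by_contra! h
  obtain ⟨i, hi⟩ : ∃ i, τ i ≠ s i := by
    by_contra! h'
    exact h.2 (Equiv.ext h')
  have hi' : τ i = i := (hτ i).resolve_right hi
  have hstep : ∀ j, τ j = j → τ (s⁻¹ j) = s⁻¹ j := by
    intro j hj
    rcases hτ (s⁻¹ j) with h1 | h1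
    · exact h1
    · rw [Equiv.Perm.inv_def, Equiv.apply_symm_apply] at h1
      have := τ.injective (h1.trans hj.symm)
      rw [Equiv.Perm.inv_def, this, hj]
  have hpow : ∀ m : ℕ, τ ((s⁻¹ ^ m) i) = (s⁻¹ ^ m) i := by
    intro m
    induction m with
    | zero => simpa using hi'
    | succ m ih =>
      rw [pow_succ', Equiv.Perm.mul_apply]
      exact hstep _ ih
  apply h.1
  ext j
  obtain ⟨m, -, rfl⟩ := (Equiv.Perm.sameCycle_inv.2 (hs i j)).exists_pow_eq'
  exact hpow m

/-- In the Leibniz expansion only `1` and `s` contribute. The sign of the full cycle turns `(-X)^N`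
into `-X^N`. -/
theorem det_one_sub_X_smul_permMatrix_of_sameCycle [Nonempty β] {s : Equiv.Perm β}
    (hs : ∀ i j, s.SameCycle i j) :
    (1 - (X : ℤ[X]) • (s⁻¹.permMatrix ℤ).map C).det = 1 - X ^ Fintype.card β := by
  rcases subsingleton_or_nontrivial β with hβ | hβ
  · obtain ⟨i⟩ := ‹Nonempty β›
    rw [Matrix.det_eq_elem_of_subsingleton _ i, one_sub_X_smul_permMatrix_apply,
      if_pos rfl, if_pos (Subsingleton.elim _ _), Fintype.card_eq_one_iff.2
        ⟨i, fun j => Subsingleton.elim _ _⟩, pow_one]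
  · have hne : ∀ i, s i ≠ i := by
      intro i hi
      obtain ⟨j, hj⟩ := exists_ne i
      obtain ⟨m, hm⟩ := hs i j
      rw [Equiv.Perm.zpow_apply_eq_self_of_apply_eq_self hi] at hm
      exact hj hm.symm
    obtain ⟨i₀⟩ := ‹Nonempty β›
    have h1s : (1 : Equiv.Perm β) ≠ s := fun h => hne i₀ (by rw [← h]; rfl)
    have hcyc : s.IsCycle := ⟨i₀, hne i₀, fun j _ => hs i₀ j⟩
    have hsupp : s.support = Finset.univ := by
      ext i
      simpa using hne i
    rw [Matrix.det_apply, ← Finset.sum_subset (Finset.subset_univ {1, s}), Finset.sum_pair h1s]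
    · have e1 : ∀ i, (1 - (X : ℤ[X]) • (s⁻¹.permMatrix ℤ).map C) ((1 : Equiv.Perm β) i) i = 1 :=
        fun i => by
          rw [one_sub_X_smul_permMatrix_apply, if_pos (Equiv.Perm.one_apply i),
            if_neg fun h => hne i h.symm, sub_zero]
      have e2 : ∀ i, (1 - (X : ℤ[X]) • (s⁻¹.permMatrix ℤ).map C) (s i) i = -X := fun i => by
        rw [one_sub_X_smul_permMatrix_apply, if_neg (hne i), if_pos rfl, zero_sub]
      rw [Finset.prod_congr rfl fun i _ => e1 i, Finset.prod_congr rfl fun i _ => e2 i]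
      rw [Finset.prod_const_one, Finset.prod_const, Equiv.Perm.sign_one, hcyc.sign, hsupp,
        Finset.card_univ, one_smul, sub_eq_add_neg, neg_pow (X : ℤ[X]), Units.smul_def, zsmul_eq_mul]
      push_cast
      rw [neg_mul, ← mul_assoc, ← mul_pow]
      simp
    · intro τ _ hτ
      obtain ⟨i, hi1, hi2⟩ : ∃ i, τ i ≠ i ∧ τ i ≠ s i := by
        by_contra! h
        have := eq_one_or_eq_of_forall_sameCycle hs (τ := τ) fun i => by
          by_cases h' : τ i = i
          · exact Or.inl h'
          · exact Or.inr (h i h')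
        simp [this] at hτ
      rw [Finset.prod_eq_zero (Finset.mem_univ i), smul_zero]
      rw [one_sub_X_smul_permMatrix_apply, if_neg hi1, if_neg hi2, sub_zero]

/-- The matrix is block diagonal along the cycles. Labelling each point by its cycle representative
makes it block triangular for the order on `β`, with one block per cycle. -/
theorem charpolyRev_permMatrix_inv [LinearOrder β] (σ : Equiv.Perm β) :
    (σ⁻¹.permMatrix ℤ).charpolyRev = weightPoly (Cyc.len (σ := σ)) := by
  set b : β → β := fun i => (Cyc.mk σ i).rep with hb
  have hrep : Function.Injective (Cyc.rep (σ := σ)) := fun x y h => by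
    rw [← Cyc.mk_rep x, h, Cyc.mk_rep]
  have htri : (1 - (X : ℤ[X]) • (σ⁻¹.permMatrix ℤ).map C).BlockTriangular b := by
    intro i j hij
    rw [one_sub_X_smul_permMatrix_apply, if_neg, if_neg, sub_zero]
    · rintro rfl
      simp [hb, Cyc.mk_apply] at hij
    · rintro rfl
      exact lt_irrefl _ hij
  have himg : Finset.univ.image b = Finset.univ.image (Cyc.rep (σ := σ)) := by
    ext i
    simp only [Finset.mem_image, Finset.mem_univ, true_and, hb]
    constructor
    · rintro ⟨j, rfl⟩
      exact ⟨_, rfl⟩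
    · rintro ⟨x, rfl⟩
      exact ⟨x.rep, by rw [Cyc.mk_rep]⟩
  rw [Matrix.charpolyRev, htri.det, himg, Finset.prod_image hrep.injOn, weightPoly]
  refine Finset.prod_congr rfl fun x _ => ?_
  have hmem : ∀ i, b i = x.rep ↔ Cyc.mk σ i = x := fun i => hrep.eq_iff
  have hinv : ∀ i, b (σ i) = x.rep ↔ b i = x.rep := fun i => by simp only [hb, Cyc.mk_apply]
  set s : Equiv.Perm {i // b i = x.rep} := σ.subtypePerm hinv with hs
  have : Nonempty {i // b i = x.rep} := ⟨⟨x.rep, by rw [hmem, Cyc.mk_rep]⟩⟩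
  have hcyc : ∀ i j, s.SameCycle i j := fun i j => by
    rw [hs, Equiv.Perm.sameCycle_subtypePerm, ← Cyc.mk_eq_iff, (hmem _).1 i.2, (hmem _).1 j.2]
  have hdet := det_one_sub_X_smul_permMatrix_of_sameCycle hcyc
  have hcard : Fintype.card {i // b i = x.rep} = x.len := by
    rw [Fintype.card_subtype, Cyc.len]
    simp only [hmem]
  rw [hcard] at hdet
  rw [← hdet]
  congr 1
  ext1 i j
  rw [Matrix.toSquareBlock_def, Matrix.of_apply, one_sub_X_smul_permMatrix_apply,
    one_sub_X_smul_permMatrix_apply]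
  simp only [Subtype.ext_iff, hs, Equiv.Perm.subtypePerm_apply]

end Det

/-! ### Fixed lattice points of the dilated hypersimplex. -/

section Lattice

variable {k n : ℕ}

theorem mem_latticePoints_hypersimplex_iff {m : ℕ} (hm : 0 < m) {x : Fin n → ℤ} :
    x ∈ latticePoints (hypersimplex k n) m ↔
      (∀ i, 0 ≤ x i ∧ x i ≤ m) ∧ ∑ i, x i = (k * m : ℕ) := by
  have hm' : (0 : ℝ) < m := Nat.cast_pos.2 hm
  constructor
  · rintro ⟨y, ⟨hy, hys⟩, hxy⟩
    have h : ∀ i, (x i : ℝ) = m * y i := fun i => congrFun hxy i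
    refine ⟨fun i => ⟨?_, ?_⟩, ?_⟩
    · have := mul_nonneg hm'.le (hy i).1
      rw [← h] at this
      exact_mod_cast this
    · have := mul_le_mul_of_nonneg_left (hy i).2 hm'.le
      rw [← h, mul_one] at this
      exact_mod_cast this
    · have : ((∑ i, x i : ℤ) : ℝ) = ((k * m : ℕ) : ℤ) := by
        push_cast
        simp only [h]
        rw [← Finset.mul_sum, hys, mul_comm]
      exact_mod_cast this
  · rintro ⟨hx, hxs⟩
    refine ⟨fun i => x i / m, ⟨fun i => ⟨?_, ?_⟩, ?_⟩, ?_⟩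
    · exact div_nonneg (by exact_mod_cast (hx i).1) hm'.le
    · rw [div_le_one hm']
      exact_mod_cast (hx i).2
    · rw [← Finset.sum_div, div_eq_iff hm'.ne']
      exact_mod_cast hxs
    · funext i
      rw [Pi.smul_apply, smul_eq_mul, mul_div_cancel₀ _ hm'.ne']

theorem finite_latticePoints_hypersimplex {m : ℕ} (hm : 0 < m) :
    Finite (latticePoints (hypersimplex k n) m) := by
  refine ((Set.finite_Icc (0 : Fin n → ℤ) fun _ => (m : ℤ)).subset fun x hx => ?_).to_subtype
  rw [mem_latticePoints_hypersimplex_iff hm] at hx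
  exact ⟨fun i => (hx.1 i).1, fun i => (hx.1 i).2⟩

theorem permGL_mulVec_int (σ : Equiv.Perm (Fin n)) (x : Fin n → ℤ) :
    (permGL n σ : Matrix (Fin n) (Fin n) ℤ).mulVec x = fun i => x (σ⁻¹ i) := by
  funext i
  simp [permGL, Matrix.mulVec, dotProduct, Equiv.Perm.permMatrix, PEquiv.toMatrix_apply,
    Equiv.toPEquiv_apply]

theorem apply_rep_of_invariant {α β : Type*} {σ : Equiv.Perm α} {x : α → β}
    (hx : ∀ i, x (σ⁻¹ i) = x i) (i : α) : x (Cyc.mk σ i).rep = x i := by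
  have hx' : ∀ i, x (σ i) = x i := fun i => by
    have := hx (σ i)
    rw [Equiv.Perm.inv_def, Equiv.symm_apply_apply] at this
    exact this.symm
  have h : ∀ z : ℤ, ∀ i, x ((σ ^ z) i) = x i := by
    intro z
    induction z using Int.induction_on with
    | zero => simp
    | succ m ih =>
      intro i
      rw [zpow_add, Equiv.Perm.mul_apply, ih, zpow_one, hx']
    | pred m ih =>
      intro i
      rw [zpow_sub, Equiv.Perm.mul_apply, ih, zpow_one, hx]
  conv_rhs => rw [← zpow_cycExp (σ := σ) i, h]

theorem sum_eq_sum_len_mul (σ : Equiv.Perm (Fin n)) (y : Cyc σ → ℤ) :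
    ∑ i, y (Cyc.mk σ i) = ∑ c : Cyc σ, (c.len : ℤ) * y c := by
  rw [← Finset.sum_fiberwise Finset.univ (Cyc.mk σ)]
  refine Finset.sum_congr rfl fun c _ => ?_
  rw [Finset.sum_congr rfl fun i hi => congrArg y (Finset.mem_filter.1 hi).2, Finset.sum_const,
    nsmul_eq_mul]
  rfl

theorem boxPoly_coeff {R : Type*} [Fintype R] [DecidableEq R] (w : R → ℕ) (M N : ℕ) :
    (boxPoly w M).coeff N = (((Fintype.piFinset fun _ : R => Finset.range M).filter
      fun y => ∑ x, w x * y x = N).card : ℤ) := by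
  rw [boxPoly_eq_sum, Polynomial.finsetSum_coeff]
  simp only [Polynomial.coeff_X_pow, eq_comm (a := N)]
  rw [Finset.sum_boole]

/-- A fixed lattice point is constant on cycles, hence a choice of a value in `{0, …, m}` for each
cycle, with the sum weighted by cycle lengths. -/
theorem card_fixedBy_latticePoints (σ : Equiv.Perm (Fin n)) {m : ℕ} (hm : 0 < m) :
    let _ := latticeAction (permGL n) (hypersimplex k n) (hypersimplex_isInvariant k n) m
    (Nat.card (MulAction.fixedBy (latticePoints (hypersimplex k n) m) σ) : ℤ) =
      (boxPoly (Cyc.len (σ := σ)) (m + 1)).coeff (k * m) := by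
  let _ := latticeAction (permGL n) (hypersimplex k n) (hypersimplex_isInvariant k n) m
  have hfix : ∀ x : latticePoints (hypersimplex k n) m,
      x ∈ MulAction.fixedBy (latticePoints (hypersimplex k n) m) σ ↔
        ∀ i, x.1 (σ⁻¹ i) = x.1 i := by
    intro x
    rw [MulAction.mem_fixedBy, Subtype.ext_iff]
    change (permGL n σ : Matrix (Fin n) (Fin n) ℤ).mulVec x.1 = x.1 ↔ _
    rw [permGL_mulVec_int]
    exact funext_iff
  rw [boxPoly_coeff, ← Fintype.card_coe, ← Nat.card_eq_fintype_card]
  congr 1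
  refine Nat.card_congr ?_
  refine
    { toFun := fun x => ⟨fun c => (x.1.1 c.rep).toNat, ?_⟩
      invFun := fun y => ⟨⟨fun i => (y.1 (Cyc.mk σ i) : ℤ), ?_⟩, ?_⟩
      left_inv := ?_
      right_inv := ?_ }
  · obtain ⟨⟨x, hx⟩, hfx⟩ := x
    rw [hfix] at hfx
    dsimp only at hfx ⊢
    rw [mem_latticePoints_hypersimplex_iff hm] at hx
    rw [Finset.mem_filter, Fintype.mem_piFinset]
    refine ⟨fun c => Finset.mem_range.2 ?_, ?_⟩
    · have := hx.1 c.rep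
      omega
    · have h := sum_eq_sum_len_mul σ fun c => x c.rep
      simp only [apply_rep_of_invariant hfx] at h
      rw [hx.2] at h
      zify at h ⊢
      rw [h]
      refine Finset.sum_congr rfl fun c _ => ?_
      rw [Int.toNat_of_nonneg (hx.1 c.rep).1]
  · obtain ⟨y, hy⟩ := y
    rw [Finset.mem_filter, Fintype.mem_piFinset] at hy
    rw [mem_latticePoints_hypersimplex_iff hm]
    refine ⟨fun i => ⟨Int.natCast_nonneg _, ?_⟩, ?_⟩
    · have := Finset.mem_range.1 (hy.1 (Cyc.mk σ i))
      dsimp only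
      omega
    · rw [sum_eq_sum_len_mul σ fun c => (y c : ℤ), ← hy.2]
      push_cast
      rfl
  · rw [hfix]
    intro i
    dsimp only
    have := Cyc.mk_apply (σ := σ) (σ⁻¹ i)
    rw [Equiv.Perm.inv_def, Equiv.apply_symm_apply] at this
    rw [this]
    rfl
  · rintro ⟨⟨x, hx⟩, hfx⟩
    apply Subtype.ext
    apply Subtype.ext
    rw [hfix] at hfx
    rw [mem_latticePoints_hypersimplex_iff hm] at hx
    funext i
    dsimp only at hfx ⊢
    rw [apply_rep_of_invariant hfx, Int.toNat_of_nonneg (hx.1 i).1]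
  · rintro ⟨y, hy⟩
    apply Subtype.ext
    funext c
    dsimp only
    rw [Cyc.mk_rep, Int.toNat_natCast]

theorem ehrhartCharacter_hypersimplex (m : ℕ) (σ : Equiv.Perm (Fin n)) :
    ehrhartCharacter (permGL n) (hypersimplex k n) (hypersimplex_isInvariant k n) m σ =
      (((boxPoly (Cyc.len (σ := σ)) (m + 1)).coeff (k * m) : ℤ) : ℂ) := by
  cases m with
  | zero =>
    -- For `m = 0` the box polynomial is `1`, in agreement with the convention for `χ_0`.
    simp [ehrhartCharacter, boxPoly]
  | succ m =>
    let _ := latticeAction (permGL n) (hypersimplex k n) (hypersimplex_isInvariant k n) (m + 1)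
    have := finite_latticePoints_hypersimplex (k := k) (n := n) (Nat.succ_pos m)
    rw [← card_fixedBy_latticePoints σ (Nat.succ_pos m), Int.cast_natCast]
    exact permCharacter_apply σ

theorem coeff_hypersimplexHStar (hk : 0 < k) (σ : Equiv.Perm (Fin n)) (i : ℕ) :
    PowerSeries.coeff i (hypersimplexHStar k n) σ =
      (((numeratorPoly (Cyc.len (σ := σ)) k).coeff i : ℤ) : ℂ) := by
  have h := congrArg (PowerSeries.coeff i)
    (mk_boxPoly_mul_weightPoly (w := Cyc.len (σ := σ)) Cyc.len_pos hk)
  rw [Polynomial.coeff_coe] at h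
  rw [← h, hypersimplexHStar, HStar, PowerSeries.coeff_mul, PowerSeries.coeff_mul, Finset.sum_apply]
  push_cast
  refine Finset.sum_congr rfl fun p _ => ?_
  rw [Pi.mul_apply, equivariantEhrhartSeries, detSeries, PowerSeries.coeff_mk, PowerSeries.coeff_mk,
    PowerSeries.coeff_mk, ehrhartCharacter_hypersimplex, ← charpolyRev_permMatrix_inv]
  rfl

end Lattice

/-! ### Cycle types and the explicit formula. -/

section Partition

variable {α : Type*} [Fintype α]

theorem Cyc.len_eq_one_iff {σ : Equiv.Perm α} (i : α) : (Cyc.mk σ i).len = 1 ↔ σ i = i := by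
  have h := zpow_apply_eq_self_iff (σ := σ) 1 i
  rw [zpow_one] at h
  rw [h, Int.natCast_dvd, Int.natAbs_one, Nat.dvd_one]

/-- Cycles of length other than `1` correspond to the cycle factors through `cycleOf`; cycles of
length `1` are the points outside the support. -/
theorem map_len_eq_parts [DecidableEq α] (σ : Equiv.Perm α) :
    (Finset.univ : Finset (Cyc σ)).val.map Cyc.len = σ.partition.parts := by
  have h1 : ((Finset.univ.filter fun x : Cyc σ => ¬ x.len = 1)).val.map Cyc.len =
      σ.cycleType := by
    have hne : ∀ x : Cyc σ, ¬ x.len = 1 → x.rep ∈ σ.support := fun x hx => by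
      rw [Equiv.Perm.mem_support, Ne, ← Cyc.len_eq_one_iff, Cyc.mk_rep]
      exact hx
    have himg : σ.cycleFactorsFinset = (Finset.univ.filter fun x : Cyc σ => ¬ x.len = 1).image
        fun x => σ.cycleOf x.rep := by
      ext c
      simp only [Finset.mem_image, Finset.mem_filter, Finset.mem_univ, true_and]
      constructor
      · intro hc
        obtain ⟨i, hi⟩ := (Equiv.Perm.mem_cycleFactorsFinset_iff.1 hc).1.nonempty_support
        have hci := Equiv.Perm.cycle_is_cycleOf hi hc
        refine ⟨Cyc.mk σ i, ?_, ?_⟩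
        · rw [Cyc.len_eq_one_iff, ← ne_eq, ← Equiv.Perm.mem_support]
          exact Equiv.Perm.mem_cycleFactorsFinset_support_le hc hi
        · rw [hci]
          exact (Cyc.mk_eq_iff.1 (Cyc.mk_rep _)).cycleOf_eq
      · rintro ⟨x, hx, rfl⟩
        exact Equiv.Perm.cycleOf_mem_cycleFactorsFinset_iff.2 (hne x hx)
    have hinj : Set.InjOn (fun x : Cyc σ => σ.cycleOf x.rep)
        (Finset.univ.filter fun x : Cyc σ => ¬ x.len = 1) := by
      intro x hx y _ hxy
      simp only [Finset.coe_filter, Finset.mem_univ, true_and, Set.mem_ofPred_eq] at hx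
      dsimp only at hxy
      have : x.rep ∈ (σ.cycleOf y.rep).support := by
        rw [← hxy, Equiv.Perm.mem_support_cycleOf_iff]
        exact ⟨Equiv.Perm.SameCycle.refl _ _, hne x hx⟩
      rw [Equiv.Perm.mem_support_cycleOf_iff, ← Cyc.mk_eq_iff, Cyc.mk_rep, Cyc.mk_rep] at this
      exact this.1.symm
    rw [Equiv.Perm.cycleType_def, himg, Finset.image_val_of_injOn hinj, Multiset.map_map]
    refine Multiset.map_congr rfl fun x hx => ?_
    have hx' : ¬ x.len = 1 := (Finset.mem_filter.1 (Finset.mem_def.2 hx)).2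
    rw [Function.comp_apply, Function.comp_apply, Cyc.len]
    congr 1
    ext i
    rw [Equiv.Perm.mem_support_cycleOf_iff, Finset.mem_filter, ← Cyc.mk_eq_iff, Cyc.mk_rep]
    simp [hne x hx', eq_comm]
  have h2 : ((Finset.univ.filter fun x : Cyc σ => x.len = 1)).val.map Cyc.len =
      Multiset.replicate (Fintype.card α - σ.support.card) 1 := by
    rw [Multiset.eq_replicate]
    constructor
    · rw [Multiset.card_map, Finset.card_val, Finset.card_eq_sum_ones,
        Finset.sum_congr rfl fun x hx => (Finset.mem_filter.1 hx).2.symm,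
        Cyc.sum_filter_len (fun x : Cyc σ => x.len = 1), ← Finset.card_compl]
      congr 1
      ext i
      simp [Cyc.len_eq_one_iff]
    · intro b hb
      obtain ⟨x, hx, rfl⟩ := Multiset.mem_map.1 hb
      exact (Finset.mem_filter.1 (Finset.mem_def.2 hx)).2
  rw [Equiv.Perm.parts_partition, ← h1, ← h2, add_comm, ← Multiset.map_add, Finset.filter_val,
    Finset.filter_val, Multiset.filter_add_not]

theorem numCycles_eq {n : ℕ} (σ : Equiv.Perm (Fin n)) : numCycles σ = Fintype.card (Cyc σ) := by
  rw [numCycles, ← map_len_eq_parts, Multiset.card_map, Finset.card_val, Finset.card_univ]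

theorem numCyclesOfLength_eq {n : ℕ} (σ : Equiv.Perm (Fin n)) (i : ℕ) :
    numCyclesOfLength σ i = (Finset.univ.filter fun x : Cyc σ => x.len = i).card := by
  rw [numCyclesOfLength, ← map_len_eq_parts, Multiset.count_map, ← Finset.filter_val,
    Finset.card_val]
  simp only [eq_comm]

theorem gcd_insert_cycle_lengths {k n : ℕ} (σ : Equiv.Perm (Fin n)) :
    (insert k {i ∈ Finset.Icc 1 n | 1 ≤ numCyclesOfLength σ i}).gcd id =
      k.gcd (Finset.univ.gcd (Cyc.len (σ := σ))) := by
  have h : {i ∈ Finset.Icc 1 n | 1 ≤ numCyclesOfLength σ i} =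
      Finset.univ.image (Cyc.len (σ := σ)) := by
    ext i
    rw [Finset.mem_filter, numCyclesOfLength_eq, Nat.succ_le_iff, Finset.card_pos, Finset.mem_Icc,
      Finset.mem_image]
    constructor
    · rintro ⟨-, x, hx⟩
      exact ⟨x, Finset.mem_univ _, (Finset.mem_filter.1 hx).2⟩
    · rintro ⟨x, -, rfl⟩
      refine ⟨⟨x.len_pos, ?_⟩, x, by simp⟩
      exact (Finset.card_le_univ _).trans_eq (Fintype.card_fin n)
  rw [Finset.gcd_insert, h, Finset.gcd_image]
  rfl

open Polynomial

theorem one_sub_X_pow_pow (a l : ℕ) {N : ℕ} (hN : l ≤ N) :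
    (1 - (X : ℤ[X]) ^ a) ^ l =
      ∑ m ∈ Finset.range (N + 1), C ((-1) ^ m * (l.choose m : ℤ)) * X ^ (a * m) := by
  rw [sub_eq_neg_add, add_pow]
  have hsub : Finset.range (l + 1) ⊆ Finset.range (N + 1) :=
    Finset.range_subset_range.2 (by omega)
  rw [← Finset.sum_subset hsub]
  · refine Finset.sum_congr rfl fun m _ => ?_
    rw [neg_pow, one_pow, mul_one, ← pow_mul, C_mul, C_pow, C_neg, C_1]
    simp only [map_natCast]
    ring
  · intro m _ hm
    rw [Nat.choose_eq_zero_of_lt (by simpa using hm)]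
    simp

/-- Cycles of length at least `k` contribute `1` modulo `X^k`. The remaining factors are grouped by
length, and each power `(1 - X^i)^(λ_i)` is expanded by the binomial theorem. -/
theorem weightPoly_coeff_eq_sum_tuples {n k h : ℕ} (σ : Equiv.Perm (Fin n)) (hh : h < k) :
    (weightPoly (Cyc.len (σ := σ))).coeff h = ∑ I ∈ tuplesOfWeight k h,
      (-1 : ℤ) ^ (∑ j : Fin (k - 1), I j) *
        ∏ j : Fin (k - 1), ((numCyclesOfLength σ ((j : ℕ) + 1)).choose (I j) : ℤ) := by
  set A : ℤ[X] := ∏ j : Fin (k - 1), (1 - X ^ ((j : ℕ) + 1)) ^ numCyclesOfLength σ ((j : ℕ) + 1)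
    with hA
  have hAprod : A = ∏ x ∈ Finset.univ.filter (fun x : Cyc σ => x.len < k), (1 - X ^ x.len) := by
    have hmaps : ∀ x ∈ Finset.univ.filter (fun x : Cyc σ => x.len < k),
        x.len ∈ Finset.univ.image (fun j : Fin (k - 1) => (j : ℕ) + 1) := fun x hx => by
      have h1 := (Finset.mem_filter.1 hx).2
      have h2 := x.len_pos
      exact Finset.mem_image.2 ⟨⟨x.len - 1, by omega⟩, Finset.mem_univ _, by
        dsimp only
        omega⟩
    rw [← Finset.prod_fiberwise_of_maps_to hmaps, Finset.prod_image (fun a _ b _ hab => by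
      ext
      simpa using hab)]
    refine Finset.prod_congr rfl fun j _ => ?_
    rw [Finset.filter_filter, numCyclesOfLength_eq, ← Finset.prod_const]
    refine Finset.prod_congr ?_ fun x hx => ?_
    · ext x
      have := j.2
      simp only [Finset.mem_filter, Finset.mem_univ, true_and]
      omega
    · rw [(Finset.mem_filter.1 hx).2.2]
  have hB : (X : ℤ[X]) ^ k ∣
      (∏ x ∈ Finset.univ.filter (fun x : Cyc σ => ¬ x.len < k), (1 - X ^ x.len)) - 1 := by
    refine Finset.prod_induction _ (fun q : ℤ[X] => X ^ k ∣ q - 1) ?_ ?_ ?_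
    · intro p q hp hq
      have : p * q - 1 = p * (q - 1) + (p - 1) := by ring
      rw [this]
      exact dvd_add (Dvd.dvd.mul_left hq p) hp
    · simp
    · intro x hx
      rw [sub_sub_cancel_left, dvd_neg]
      exact pow_dvd_pow _ (not_lt.1 (Finset.mem_filter.1 hx).2)
  have hW : (weightPoly (Cyc.len (σ := σ))).coeff h = A.coeff h := by
    have hdvd : (X : ℤ[X]) ^ k ∣ weightPoly (Cyc.len (σ := σ)) - A := by
      rw [weightPoly, ← Finset.prod_filter_mul_prod_filter_not Finset.univ
        (fun x : Cyc σ => x.len < k), ← hAprod]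
      rw [← mul_sub_one]
      exact Dvd.dvd.mul_left hB A
    have := X_pow_dvd_iff.1 hdvd h hh
    rwa [coeff_sub, sub_eq_zero] at this
  -- One bound for all indices: the number of cycles covers the binomial expansions, and `h` covers
  -- the entries of tuples of weight `h`.
  have hle : ∀ i, numCyclesOfLength σ i ≤ Fintype.card (Cyc σ) + h := fun i => by
    rw [numCyclesOfLength_eq]
    exact (Finset.card_le_univ _).trans (Nat.le_add_right _ _)
  have hfilter : tuplesOfWeight k h = (Fintype.piFinset fun _ : Fin (k - 1) =>
      Finset.range (Fintype.card (Cyc σ) + h + 1)).filter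
        fun I => h = ∑ j : Fin (k - 1), ((j : ℕ) + 1) * I j := by
    ext I
    rw [mem_tuplesOfWeight, Finset.mem_filter, Fintype.mem_piFinset, eq_comm]
    refine ⟨fun hI => ⟨fun j => Finset.mem_range.2 ?_, hI⟩, fun hI => hI.2⟩
    have h1 := Finset.single_le_sum (f := fun j : Fin (k - 1) => ((j : ℕ) + 1) * I j)
      (fun _ _ => Nat.zero_le _) (Finset.mem_univ j)
    have h2 : I j ≤ ((j : ℕ) + 1) * I j := Nat.le_mul_of_pos_left _ (Nat.succ_pos _)
    rw [← hI] at h1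
    omega
  rw [hW, hA, Finset.prod_congr rfl fun (j : Fin (k - 1)) _ =>
      one_sub_X_pow_pow ((j : ℕ) + 1) _ (hle ((j : ℕ) + 1)),
    Finset.prod_univ_sum, finsetSum_coeff, hfilter, Finset.sum_filter]
  refine Finset.sum_congr rfl fun I _ => ?_
  rw [Finset.prod_mul_distrib, Finset.prod_pow_eq_pow_sum, ← map_prod, coeff_C_mul, coeff_X_pow,
    mul_ite, mul_one, mul_zero, Finset.prod_mul_distrib, Finset.prod_pow_eq_pow_sum]

theorem card_fixedBy_eq_formula {k n : ℕ} (hk : 0 < k) (hkn : k < n) (σ : Equiv.Perm (Fin n)) :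
    (Nat.card (MulAction.fixedBy (HypersimplicialDOSP k n) σ) : ℤ) =
      (((insert k {i ∈ Finset.Icc 1 n | 1 ≤ numCyclesOfLength σ i}).gcd id : ℕ) : ℤ) *
        ∑ h ∈ Finset.range k, (∑ I ∈ tuplesOfWeight k h, (-1 : ℤ) ^ (∑ j : Fin (k - 1), I j) *
          ∏ j : Fin (k - 1), ((numCyclesOfLength σ ((j : ℕ) + 1)).choose (I j) : ℤ)) *
            ((k : ℤ) - (h : ℤ)) ^ (numCycles σ - 1) := by
  rw [card_fixedBy_hypersimplicialDOSP hk hkn, gcd_insert_cycle_lengths, numCycles_eq]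
  congr 1
  refine Finset.sum_congr rfl fun h hh => ?_
  rw [weightPoly_coeff_eq_sum_tuples σ (Finset.mem_range.1 hh)]

/-! ### Polynomiality of the `H^*`-series and the comparison at `t = 1`. -/

/-- The equivariant `H^*`-series of the hypersimplex, as a polynomial. -/
noncomputable def hypersimplexHStarPoly (k n : ℕ) : Polynomial (Equiv.Perm (Fin n) → ℂ) :=
  ∑ i ∈ Finset.range
      ((Finset.univ.sup fun σ : Equiv.Perm (Fin n) =>
        (numeratorPoly (Cyc.len (σ := σ)) k).natDegree) + 1),
    monomial i fun σ => (((numeratorPoly (Cyc.len (σ := σ)) k).coeff i : ℤ) : ℂ)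

theorem natDegree_numeratorPoly_lt (k : ℕ) {n : ℕ} (σ : Equiv.Perm (Fin n)) :
    (numeratorPoly (Cyc.len (σ := σ)) k).natDegree < (Finset.univ.sup
      fun σ : Equiv.Perm (Fin n) => (numeratorPoly (Cyc.len (σ := σ)) k).natDegree) + 1 :=
  Nat.lt_succ_of_le (Finset.le_sup (f := fun σ : Equiv.Perm (Fin n) =>
    (numeratorPoly (Cyc.len (σ := σ)) k).natDegree) (Finset.mem_univ σ))

theorem coe_hypersimplexHStarPoly {k : ℕ} (hk : 0 < k) (n : ℕ) :
    (hypersimplexHStarPoly k n : PowerSeries (Equiv.Perm (Fin n) → ℂ)) =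
      hypersimplexHStar k n := by
  ext i σ
  rw [coeff_hypersimplexHStar hk, Polynomial.coeff_coe, hypersimplexHStarPoly, finsetSum_coeff]
  simp only [coeff_monomial]
  rw [Finset.sum_ite_eq']
  split_ifs with hi
  · rfl
  · have hlt := natDegree_numeratorPoly_lt k σ
    rw [Finset.mem_range] at hi
    rw [coeff_eq_zero_of_natDegree_lt (by omega)]
    simp

theorem hypersimplexHStarPoly_eval_one {k n : ℕ} (hk : 0 < k) (hkn : k < n)
    (σ : Equiv.Perm (Fin n)) : (hypersimplexHStarPoly k n).eval 1 σ =
      (Nat.card (MulAction.fixedBy (HypersimplicialDOSP k n) σ) : ℂ) := by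
  have : Nonempty (Cyc σ) := ⟨Cyc.mk σ ⟨0, by omega⟩⟩
  have h := (numeratorPoly_eval_one (w := Cyc.len (σ := σ)) Cyc.len_pos k).trans
    (card_fixedBy_hypersimplicialDOSP hk hkn σ).symm
  rw [eval_eq_sum_range' (natDegree_numeratorPoly_lt k σ)] at h
  rw [← Int.cast_natCast (R := ℂ), ← h, hypersimplexHStarPoly, eval_finsetSum, Finset.sum_apply]
  simp

end Partition

end EqEhrhart

theorem mainTheorem1 (k n : ℕ) (hk : 2 ≤ k) (hkn : k < n) :
    ∃ H : Polynomial (Equiv.Perm (Fin n) → ℂ),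
      (H : PowerSeries (Equiv.Perm (Fin n) → ℂ)) = EqEhrhart.hypersimplexHStar k n ∧
      H.eval 1 = EqEhrhart.permCharacter (Equiv.Perm (Fin n)) (EqEhrhart.HypersimplicialDOSP k n) ∧
      EqEhrhart.IsPermCharacter (H.eval 1) ∧
      ∀ σ : Equiv.Perm (Fin n),
        H.eval 1 σ = (Nat.card (MulAction.fixedBy (EqEhrhart.HypersimplicialDOSP k n) σ) : ℂ) ∧
        (Nat.card (MulAction.fixedBy (EqEhrhart.HypersimplicialDOSP k n) σ) : ℤ) =
          (((insert k {i ∈ Finset.Icc 1 n | 1 ≤ EqEhrhart.numCyclesOfLength σ i}).gcd id : ℕ) : ℤ) *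
            ∑ h ∈ Finset.range k,
              (∑ I ∈ EqEhrhart.tuplesOfWeight k h,
                (-1 : ℤ) ^ (∑ j : Fin (k - 1), I j) *
                  ∏ j : Fin (k - 1), ((EqEhrhart.numCyclesOfLength σ ((j : ℕ) + 1)).choose (I j) : ℤ)) *
              ((k : ℤ) - (h : ℤ)) ^ (EqEhrhart.numCycles σ - 1) := by
  have hk0 : 0 < k := by omega
  have heval := EqEhrhart.hypersimplexHStarPoly_eval_one hk0 hkn
  have hchar : (EqEhrhart.hypersimplexHStarPoly k n).eval 1 =
      EqEhrhart.permCharacter (Equiv.Perm (Fin n)) (EqEhrhart.HypersimplicialDOSP k n) := by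
    funext σ
    rw [heval, EqEhrhart.permCharacter_apply]
  exact ⟨EqEhrhart.hypersimplexHStarPoly k n, EqEhrhart.coe_hypersimplexHStarPoly hk0 n, hchar,
    ⟨_, inferInstance, inferInstance, hchar⟩,
    fun σ => ⟨heval σ, EqEhrhart.card_fixedBy_eq_formula hk0 hkn σ⟩⟩
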